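/- **Setting.** Let $\Lambda$ be a hexagonal lattice on a torus, i.e. the quotient of the hexagonal tiling of the plane by a finite-index lattice of translations, such that the 12 edges around each plaquette (see below) are distinct. Each edge carries a qubit; the computational basis states $|\vec i\rangle$ are indexed by string configurations $\vec i$ (sets of occupied edges), and $\oplus$ is addition mod 2. Around each plaquette $p$ label the edges of the hexagon cyclically by $1,\dots,6$ (with the same orientation and starting position for all $p$), and the outgoing edges $7,\dots,11,12$ at the vertices between edges $(1,2),(2,3),(3,4),(4,5),(5,6),(6,1)$. With $n^-_j\in\{0,1\}$ the occupation of edge $j$ and $n^+_j=1-n^-_j$ (indices with $n_0=n_6$), let $$b_p(\vec i)=\prod_{j=1}^6(-1)^{n^-_{j-1}n^+_j}\; i^{\,n^-_{12}(n^-_1n^-_6-n^+_1n^+_6)+n^-_7(n^+_1n^+_2-n^-_1n^-_2)+n^+_8(n^-_2n^+_3-n^+_2n^-_3)+n^-_9(n^-_3n^-_4-n^+_3n^+_4)+n^-_{10}(n^+_4n^+_5-n^-_4n^-_5)+n^+_{11}(n^-_5n^+_6-n^+_5n^-_6)},$$ so that $B_p=\prod_{j=1}^{6}\sigma^x_j\sum_{\vec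 i}b_p(\vec i)|\vec i\rangle\langle\vec i|$ is the plaquette operator of the off-shell double semion model. Let $\vec\alpha^p$ be the configuration occupied exactly on the edges of the hexagon $p$. **Paths.** A path is a sequence of edges $e_1,\dots,e_k$ with $e_i$ joining $v_{i-1}$ to $v_i$. It is closed if $v_0=v_k$ and open otherwise; self-crossing if $v_i=v_j$ for some $0<i<k$ and $j\ne i$; self-overlapping if some plaquette contains vertices of the path that do not form one consecutive sequence. For a path $\mathcal P$, $\vec\alpha^{\mathcal P}$ is the configuration occupied exactly on its edges, $\mathrm{Conn}(\mathcal P)$ is the set of edges having a vertex on $\mathcal P$, and $\mathcal B_{\mathcal P}$ is the set of plaquettes with a boundary edge in $\mathrm{Conn}(\mathcal P)$. A concatenation $\mathcal P_1\#\dots\#\mathcal P_m$ ($m\ge1$) is formed of paths each of which starts where the previous one ends. **Crossings.** Paths $\mathcal P,\mathcal Q$ cross if no end point of an open one among them lies on the other. They then cross $n$ times if exactly $n$ of the maximal nonempty common sequences of edges of $\mathcal P$ and $\mathcal Q$ (traversed by $\mathcal Q$ in the same or in the opposite direction; indices are cyclic on closed paths) have the following property: the pair formed by the edge of $\mathcal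 P$ and the edge of $\mathcal Q$ just before the sequence, and the pair just after it (both taken in the direction of $\mathcal P$), have the same relative orientation, clockwise or counterclockwise. **String operators.** For a single open path $\mathcal P$ that is neither self-crossing nor self-overlapping, a positive-chirality string operator is $S^+_{\mathcal P}=\prod_{e\in\mathcal P}\sigma^x_e\sum_{\vec i}F_{\mathcal P}(\vec i)|\vec i\rangle\langle\vec i|$, where $F_{\mathcal P}(\vec i)$ depends only on $\vec i$ restricted to $\mathrm{Conn}(\mathcal P)$ and is obtained as follows. In each class of configurations on $\mathrm{Conn}(\mathcal P)$ modulo the $\vec\alpha^p$ with $p\in\mathcal B_{\mathcal P}$ choose a representative $\vec i$ and an arbitrary phase $F_{\mathcal P}(\vec i)$, and for all subsets $\{p_1,\dots,p_r\}\subseteq\mathcal B_{\mathcal P}$ put $$F_{\mathcal P}\Big(\vec i\oplus\bigoplus_{l=1}^r\vec\alpha^{p_l}\Big)=F_{\mathcal P}(\vec i)\prod_{l=1}^r\frac{b_{p_l}\big(\vec i\oplus\vec\alpha^{\mathcal P}\oplus\bigoplus_{j<l}\vec\alpha^{p_j}\big)}{b_{p_l}\big(\vec i\oplus\bigoplus_{j<l}\vec\alpha^{p_j}\big)}.$$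 For $\mathcal P=\mathcal P_1\#\dots\#\mathcal P_m$ with such $\mathcal P_i$, put $S^+_{\mathcal P}=S^+_{\mathcal P_m}\cdots S^+_{\mathcal P_1}$. A negative-chirality string operator is $S^-_{\mathcal P}=S^+_{\mathcal P}\prod_{f\in\mathcal P'}\sigma^z_f$, where $\mathcal P'$ is a path in the dual lattice that accompanies $\mathcal P$ from its first to its last vertex, crossing only edges at the current vertex of $\mathcal P$ and moving to the next vertex of $\mathcal P$ within a plaquette containing both. If $\mathcal P$ is closed, $\mathcal P'$ is closed; if $\mathcal P$ is open, $\mathcal P'$ leads from the plaquette at the first vertex opposite to the first edge of $\mathcal P$ to the plaquette at the last vertex opposite to the last edge. **Theorem.** Let $\mathcal P=\mathcal P_1\#\dots\#\mathcal P_m$ and $\mathcal Q=\mathcal Q_1\#\dots\#\mathcal Q_{m'}$ be paths crossing $n$ times, where all $\mathcal P_i$ and $\mathcal Q_j$ are open and neither self-crossing nor self-overlapping. Then for all choices of $S^+_{\mathcal P}$ and $S^+_{\mathcal Q}$, $$[S^+_{\mathcal P},S^+_{\mathcal Q}]=0\ \text{ if } n \text{ is even},\qquad \{S^+_{\mathcal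 P},S^+_{\mathcal Q}\}=0\ \text{ if } n\text{ is odd}.$$ More generally, let $S^{1}=1$ and let $S^{s^+}_{\mathcal P}$, $S^{s^-}_{\mathcal P}$, $S^{s^+s^-}_{\mathcal P}$ be of the form $S^+_{\mathcal P}$, $S^-_{\mathcal P}$, $S^+_{\mathcal P}S^-_{\mathcal P}$ respectively (and likewise for $\mathcal Q$). Then for all $a,b\in\{1,s^+,s^-,s^+s^-\}$, $$S^{a}_{\mathcal P}S^{b}_{\mathcal Q}=(2S_{ab})^n\,S^{b}_{\mathcal Q}S^{a}_{\mathcal P},\qquad S=\frac12\begin{pmatrix}1&1&1&1\\1&-1&1&-1\\1&1&-1&-1\\1&-1&-1&1\end{pmatrix},$$ i.e. the mutual statistics are semionic and $S$ is the topological $S$-matrix in the basis $(1,s^+,s^-,s^+s^-)$. -/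

import Mathlib

noncomputable section

namespace DoubleSemion

/-! ## The hexagonal lattice on a torus

A tiling of a closed oriented surface by hexagons, three of them around each vertex, is the
quotient of the hexagonal tiling of the plane by a lattice `L` of translations. The plane tiling has
two vertices per unit cell `g`: an `A`-vertex `(g, false)` and a `B`-vertex `(g, true)`. The three
edges at each vertex are labelled by `0, 1, 2 : ZMod 3`, in counterclockwise order, and an edge has
the same label at both of its ends. -/

/-- Unit cells. -/
abbrev Cell (L : AddSubgroup (ℤ × ℤ)) : Type := (ℤ × ℤ) ⧸ L

/-- Vertices: `(g, false)` is the `A`-vertex and `(g, true)` the `B`-vertex of the cell `g`. -/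
abbrev Vertex (L : AddSubgroup (ℤ × ℤ)) : Type := Cell L × Bool

/-- Edges (each carries a qubit): `(g, k)` joins the `A`-vertex of `g` to the `B`-vertex of
`g + offset k`. -/
abbrev Edge (L : AddSubgroup (ℤ × ℤ)) : Type := Cell L × ZMod 3

/-- Plaquettes (hexagons), one for each unit cell. -/
abbrev Plaquette (L : AddSubgroup (ℤ × ℤ)) : Type := Cell L

variable {L : AddSubgroup (ℤ × ℤ)}

/-- Displacement of the unit cell along an edge with label `k`, from its `A`-end to its `B`-end. -/
def offset (k : ZMod 3) : ℤ × ℤ :=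
  if k = 0 then (0, 0) else if k = 1 then (1, 0) else (0, 1)

/-- The other end of the edge with label `k` at the vertex `v`. -/
def step (v : Vertex L) (k : ZMod 3) : Vertex L :=
  match v with
  | (g, false) => (g + (offset k : Cell L), true)
  | (g, true) => (g - (offset k : Cell L), false)

/-- The edge with label `k` at the vertex `v`. -/
def edgeOf (v : Vertex L) (k : ZMod 3) : Edge L :=
  match v with
  | (g, false) => (g, k)
  | (g, true) => (g - (offset k : Cell L), k)

/-- The three edges that meet at a vertex. -/
def star (v : Vertex L) : Set (Edge L) := Set.range (edgeOf v)

/-- The `j`-th vertex met when going around the hexagon `p`, starting at the `A`-vertex of the cell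
`p` and following edges with labels `0, 1, 2, 0, 1, 2` (so `corner p 6 = corner p 0`). -/
def corner (p : Plaquette L) : ℕ → Vertex L
  | 0 => (p, false)
  | j + 1 => step (corner p j) (j : ZMod 3)

/-- The twelve edges around a plaquette: edges `1, …, 6` are the consecutive edges of the hexagon,
edge `6 + j` (`1 ≤ j ≤ 5`) is the outgoing edge at the vertex between edges `j` and `j + 1`, and
edge `12` is the outgoing edge at the vertex between edges `6` and `1`. -/
def plaquetteEdge (p : Plaquette L) (j : ℕ) : Edge L :=
  if j ≤ 6 then edgeOf (corner p (j - 1)) ((j - 1 : ℕ) : ZMod 3)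
  else edgeOf (corner p (j - 6)) ((j - 6 + 1 : ℕ) : ZMod 3)

/-- The six edges of the hexagon `p`. -/
def boundary (p : Plaquette L) : Set (Edge L) := plaquetteEdge p '' Set.Icc 1 6

/-- The six vertices of the hexagon `p`. -/
def corners (p : Plaquette L) : Set (Vertex L) := corner p '' Set.Iio 6

/-- The torus is not degenerately small: the twelve edges around each plaquette are distinct. -/
def Nondegenerate (L : AddSubgroup (ℤ × ℤ)) : Prop :=
  ∀ p : Plaquette L, Set.InjOn (plaquetteEdge p) (Set.Icc 1 12)

/-! ## String configurations, operators and plaquette phases -/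

/-- String configurations; `1` means occupied. Addition is `⊕` (flipping). -/
abbrev Config (L : AddSubgroup (ℤ × ℤ)) : Type := Edge L → ZMod 2

/-- The Hilbert space of the qubits: amplitudes on string configurations. -/
abbrev State (L : AddSubgroup (ℤ × ℤ)) : Type := Config L → ℂ

/-- Linear operators on the Hilbert space of the qubits. -/
abbrev Operator (L : AddSubgroup (ℤ × ℤ)) : Type := Module.End ℂ (State L)

open Classical in
/-- The configuration occupied exactly on the set `s`. -/
def occupied (s : Set (Edge L)) : Config L := fun e => if e ∈ s then 1 else 0

/-- The product of `σˣ` over the occupied edges of `α`, that is `|i⟩ ↦ |i ⊕ α⟩`. -/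
def flip (α : Config L) : Operator L := LinearMap.funLeft ℂ ℂ (fun i => i + α)

/-- The diagonal operator `∑ᵢ F(i) |i⟩⟨i|`. -/
def diagonal (F : Config L → ℂ) : Operator L := LinearMap.mulLeft ℂ F

/-- The Pauli operator `σᶻ` on the qubit `e`. -/
def sigmaZ (e : Edge L) : Operator L := diagonal fun i => (-1) ^ (i e).val

/-- `n⁻` on edge `j` around the plaquette `p`: `1` if occupied and `0` if not. -/
def nMinus (p : Plaquette L) (i : Config L) (j : ℕ) : ℤ := ((i (plaquetteEdge p j)).val : ℤ)

/-- `n⁺ = 1 - n⁻` on edge `j` around the plaquette `p`. -/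
def nPlus (p : Plaquette L) (i : Config L) (j : ℕ) : ℤ := 1 - nMinus p i j

/-- The phase `b_p(i)` of the generalized plaquette operator
`B_p = (∏_{j ∈ ∂p} σˣ_j) ∑ᵢ b_p(i) |i⟩⟨i|` of the off-shell double semion model. -/
def plaquettePhase (p : Plaquette L) (i : Config L) : ℂ :=
  let m := nMinus p i
  let q := nPlus p i
  (-1) ^ (m 6 * q 1 + m 1 * q 2 + m 2 * q 3 + m 3 * q 4 + m 4 * q 5 + m 5 * q 6) *
  (Complex.I ^ (m 12 * (m 1 * m 6 - q 1 * q 6)) * Complex.I ^ (m 7 * (q 1 * q 2 - m 1 * m 2)) *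
   Complex.I ^ (q 8 * (m 2 * q 3 - q 2 * m 3)) * Complex.I ^ (m 9 * (m 3 * m 4 - q 3 * q 4)) *
   Complex.I ^ (m 10 * (q 4 * q 5 - m 4 * m 5)) * Complex.I ^ (q 11 * (m 5 * q 6 - q 5 * m 6)))

/-! ## Paths -/

/-- A path: its initial vertex `v₀` together with the labels of its consecutive edges. (Since the
edges at a vertex carry different labels, this is the same as a sequence of edges `e₁, …, eₙ` with
`eᵢ` connecting `vᵢ₋₁` to `vᵢ`.) -/
@[ext] structure Path (L : AddSubgroup (ℤ × ℤ)) where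
  start : Vertex L
  labels : List (ZMod 3)

namespace Path

/-- The number of edges. -/
def len (P : Path L) : ℕ := P.labels.length

/-- The vertex `vᵢ`, for `0 ≤ i ≤ len`. -/
def vert (P : Path L) (i : ℕ) : Vertex L := (P.labels.take i).foldl step P.start

/-- The last vertex. -/
def finish (P : Path L) : Vertex L := P.vert P.len

/-- The edge from `vᵢ` to `vᵢ₊₁`, for `0 ≤ i < len`. -/
def edge? (P : Path L) (i : ℕ) : Option (Edge L) := P.labels[i]?.map (edgeOf (P.vert i))

/-- The set of vertices of a path, end points included. -/
def vertexSet (P : Path L) : Set (Vertex L) := {v | ∃ i ≤ P.len, P.vert i = v}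

/-- The set of edges of a path. -/
def edgeSet (P : Path L) : Set (Edge L) := {e | ∃ i, P.edge? i = some e}

/-- The path traversed backwards. -/
def reverse (P : Path L) : Path L := ⟨P.finish, P.labels.reverse⟩

def IsClosed (P : Path L) : Prop := P.start = P.finish

def IsOpen (P : Path L) : Prop := ¬ P.IsClosed

def SelfCrossing (P : Path L) : Prop :=
  ∃ i j, 0 < i ∧ i < P.len ∧ j ≤ P.len ∧ j ≠ i ∧ P.vert i = P.vert j

/-- Some plaquette contains vertices of the path that do not form a single consecutive
sequence. -/
def SelfOverlapping (P : Path L) : Prop :=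
  ∃ p : Plaquette L, ∃ i j k, i < j ∧ j < k ∧ k ≤ P.len ∧
    P.vert i ∈ corners p ∧ P.vert j ∉ corners p ∧ P.vert k ∈ corners p

/-- `P = P₁ # … # Pₘ` with `m ≥ 1`, where each `Pᵢ` is open, not self-crossing and not
self-overlapping, and begins where the previous one ends. -/
def IsConcatenation (P : Path L) (Ps : List (Path L)) : Prop :=
  (∀ R ∈ Ps, R.IsOpen ∧ ¬ R.SelfCrossing ∧ ¬ R.SelfOverlapping) ∧
  Ps.IsChain (fun R R' => R.finish = R'.start) ∧
  Ps.head?.map start = some P.start ∧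
  P.labels = Ps.flatMap labels

/-- The configuration `α^P`, occupied exactly on the edges of `P`. -/
def config (P : Path L) : Config L := occupied P.edgeSet

/-- `Conn(P)`: the edges of `P` and its external legs. -/
def conn (P : Path L) : Set (Edge L) := {e | ∃ v ∈ P.vertexSet, e ∈ star v}

/-- `B_P`: the plaquettes that have a boundary edge in `Conn(P)`. -/
def plaquettes (P : Path L) : Set (Plaquette L) := {p | (boundary p ∩ P.conn).Nonempty}

/-! ### Crossings -/

/-- The label of the edge that follows the vertex with index `i`; indices are cyclic if the path is
closed. -/
def labelAt (P : Path L) (i : ℤ) : Option (ZMod 3) :=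
  open Classical in
  if P.IsClosed then P.labels[(i % (P.len : ℤ)).toNat]?
  else if 0 ≤ i then P.labels[i.toNat]? else none

/-- The vertex with index `i`; indices are cyclic if the path is closed. -/
def vertAt (P : Path L) (i : ℤ) : Vertex L :=
  open Classical in
  if P.IsClosed then P.vert (i % (P.len : ℤ)).toNat else P.vert i.toNat

/-- Two different edges at a vertex, given by their labels `k` and `k'`: the second is the
next one counterclockwise after the first. As three edges meet at a vertex, it is otherwise the
next one clockwise. -/
def Counterclockwise (k k' : ZMod 3) : Prop := k' = k + 1

/-- `P` and `Q` run in the same direction along a common sequence of `ℓ ≥ 1` edges, which starts at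
index `a` on `P` and at index `b` on `Q` and is maximal, and they cross over it: the pair of edges
preceding it and the pair of edges following it have the same relative orientation. -/
def CrossesOver (P Q : Path L) (a b : ℤ) (ℓ : ℕ) : Prop :=
  1 ≤ ℓ ∧
  (∀ k : ℕ, k ≤ ℓ → P.vertAt (a + k) = Q.vertAt (b + k)) ∧
  (∀ k : ℕ, k < ℓ → ∃ d, P.labelAt (a + k) = some d ∧ Q.labelAt (b + k) = some d) ∧
  ∃ d₁ d₁' d₂ d₂',
    P.labelAt (a - 1) = some d₁ ∧ Q.labelAt (b - 1) = some d₁' ∧ d₁ ≠ d₁' ∧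
    P.labelAt (a + ℓ) = some d₂ ∧ Q.labelAt (b + ℓ) = some d₂' ∧ d₂ ≠ d₂' ∧
    (Counterclockwise d₁ d₁' ↔ Counterclockwise d₂ d₂')

/-- The number of regions over which `P` and `Q` cross, among those where they run in the same
direction. -/
def parallelCrossings (P Q : Path L) : ℕ :=
  Nat.card {ab : Fin P.len × Fin Q.len //
    ∃ ℓ : ℕ, P.CrossesOver Q ((ab.1 : ℕ) : ℤ) ((ab.2 : ℕ) : ℤ) ℓ}

/-- The number of regions over which `P` and `Q` cross. -/
def crossingNumber (P Q : Path L) : ℕ :=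
  P.parallelCrossings Q + P.parallelCrossings Q.reverse

/-- The end points of an open path do not lie on the other path. For two closed paths this
is no condition. -/
def Cross (P Q : Path L) : Prop :=
  (P.IsOpen → P.start ∉ Q.vertexSet ∧ P.finish ∉ Q.vertexSet) ∧
  (Q.IsOpen → Q.start ∉ P.vertexSet ∧ Q.finish ∉ P.vertexSet)

/-- `P` and `Q` cross `n` times. -/
def CrossTimes (P Q : Path L) (n : ℕ) : Prop := P.Cross Q ∧ P.crossingNumber Q = n

/-! ### Positive-chirality string operators -/

/-- `θ_P(i, p₁, …, pₘ)`. -/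
def theta (P : Path L) (i : Config L) : List (Plaquette L) → ℂ
  | [] => 1
  | p :: ps => plaquettePhase p (i + P.config) / plaquettePhase p i *
      theta P (i + occupied (boundary p)) ps

/-- `j` is in the configuration class of `i`: on `Conn(P)` they differ by a set of plaquettes of
`B_P`. -/
def SameClass (P : Path L) (i j : Config L) : Prop :=
  ∃ T : Finset (Plaquette L), (T : Set (Plaquette L)) ⊆ P.plaquettes ∧
    ∀ e ∈ P.conn, j e = i e + (∑ p ∈ T, occupied (boundary p)) e

/-- `F` is a possible output of the algorithm that determines the phases of the string operator on
`P`: `F` depends on the configuration on `Conn(P)` only; in each configuration class a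
representative (extended in some way to the whole lattice) gets an arbitrary phase; and for
each subset `{p₁, …, pₘ}` of `B_P`, in any order, the value at `rep ⊕ α^{p₁} ⊕ … ⊕ α^{pₘ}` is
`θ_P(rep, p₁, …, pₘ)` times the value at the representative `rep`. -/
def IsAlgorithmOutput (P : Path L) (F : Config L → ℂ) : Prop :=
  (∀ i j : Config L, Set.EqOn i j P.conn → F i = F j) ∧
  ∃ rep : Config L → Config L,
    (∀ i, P.SameClass i (rep i)) ∧
    (∀ i j, P.SameClass i j → rep i = rep j) ∧
    (∀ i, ‖F (rep i)‖ = 1) ∧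
    ∀ (i : Config L) (ps : List (Plaquette L)), ps.Nodup → (∀ p ∈ ps, p ∈ P.plaquettes) →
      F (rep i + (ps.map fun p => occupied (boundary p)).sum) = P.theta (rep i) ps * F (rep i)

/-- `S = (∏_{e ∈ P} σˣ_e) ∑ᵢ F(i) |i⟩⟨i|` with phases `F` given by the algorithm. -/
def IsSimpleString (P : Path L) (S : Operator L) : Prop :=
  ∃ F : Config L → ℂ, P.IsAlgorithmOutput F ∧ S = flip P.config * diagonal F

/-- `S = S⁺_{Pₘ} ⋯ S⁺_{P₁}` is a positive-chirality string operator on `P₁ # … # Pₘ`. -/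
def IsPositiveString (Ps : List (Path L)) (S : Operator L) : Prop :=
  ∃ Ss : List (Operator L), List.Forall₂ IsSimpleString Ps Ss ∧ S = Ss.reverse.prod

/-! ### Negative-chirality string operators -/

/-- `DualRun P p₀ t p fs`: a path in the dual lattice from the plaquette `p₀` to the plaquette `p`,
crossing the edges `fs`, that accompanies `P` from its vertex `v₀` to its vertex `vₜ`. It crosses
only edges of `Conn(P)`: those at the current vertex of `P`, in any order and number; it passes to
the next vertex of `P` while in a plaquette that contains both. -/
inductive DualRun (P : Path L) (p₀ : Plaquette L) : ℕ → Plaquette L → List (Edge L) → Prop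
  | init : P.start ∈ corners p₀ → DualRun P p₀ 0 p₀ []
  | advance {t : ℕ} {p : Plaquette L} {fs : List (Edge L)} :
      DualRun P p₀ t p fs → t < P.len → P.vert (t + 1) ∈ corners p → DualRun P p₀ (t + 1) p fs
  | cross {t : ℕ} {p q : Plaquette L} {f : Edge L} {fs : List (Edge L)} :
      DualRun P p₀ t p fs → f ∈ star (P.vert t) → f ∈ boundary p → f ∈ boundary q → p ≠ q →
      DualRun P p₀ t q (f :: fs)

/-- The edges `fs` are those crossed by a dual path accompanying the whole of `P`. If `P` is closed,
the dual path is closed (hence homologous to `P`, inside a neighbourhood of `P`); if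
`P` is open, it leads from the plaquette at `v₀` opposite to the first edge to the plaquette at the
last vertex opposite to the last edge. -/
def IsDualPath (P : Path L) (fs : List (Edge L)) : Prop :=
  ∃ p q : Plaquette L, DualRun P p P.len q fs ∧ (P.IsClosed → p = q) ∧
    (P.IsOpen → (∀ e, P.edge? 0 = some e → e ∉ boundary p) ∧
      ∀ e, P.edge? (P.len - 1) = some e → e ∉ boundary q)

/-- `S⁻_P = S⁺_P Sᶻ`, where `Sᶻ` is the product of `σᶻ` along a dual path accompanying `P`. -/
def IsNegativeString (P : Path L) (Ps : List (Path L)) (S : Operator L) : Prop :=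
  ∃ (A : Operator L) (fs : List (Edge L)), IsPositiveString Ps A ∧ P.IsDualPath fs ∧
    S = A * (fs.map sigmaZ).prod

end Path

/-! ## Quasiparticles and the topological `S` matrix -/

/-- The quasiparticle types: the vacuum `1`, the semions `s⁺` and `s⁻`, and the composite
`s⁺s⁻`. -/
inductive Particle
  | vacuum
  | sPlus
  | sMinus
  | composite

/-- `S` is a string operator on `P = P₁ # … # Pₘ` for the given type of quasiparticle. -/
def IsStringOperator (P : Path L) (Ps : List (Path L)) (S : Operator L) : Particle → Prop
  | .vacuum => S = 1
  | .sPlus => Path.IsPositiveString Ps S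
  | .sMinus => Path.IsNegativeString P Ps S
  | .composite => ∃ A B : Operator L, Path.IsPositiveString Ps A ∧
      Path.IsNegativeString P Ps B ∧ S = A * B

/-- Position of a quasiparticle type in the basis `(1, s⁺, s⁻, s⁺s⁻)`. -/
def Particle.index : Particle → Fin 4
  | .vacuum => 0
  | .sPlus => 1
  | .sMinus => 2
  | .composite => 3

/-- The topological `S` matrix of the double semion model. For the four abelian quasiparticles (total
quantum dimension `2`) the entry `(a, b)` is half of the phase picked up when a string operator of
type `a` is commuted past a string operator of type `b` that it crosses once. -/
def topologicalS : Matrix (Fin 4) (Fin 4) ℂ :=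
  (1 / 2 : ℂ) • !![1, 1, 1, 1; 1, -1, 1, -1; 1, 1, -1, -1; 1, -1, -1, 1]

end DoubleSemion

end

/-!
# Mutual statistics of string operators in the off-shell double semion model

All phases in the model are fourth roots of unity times phases that the algorithm leaves free, so
the argument is additive in `ZMod 4`.

**Short strings.** For a single edge `e` there is an explicit string operator with phase
`I ^ edgeExp e i`, where `edgeExp` is a sum of one term for each end of `e`. It commutes with all
plaquette operators (`Generic.edgeExp_add_plaqConfig`), and two short strings commute up to the
*constant* `I ^ (-turn k k')` if they share a vertex, where `turn` is `±1` according to the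
orientation of the two edges (`Generic.edgeExp_comm`). Hence the products of short strings along two
lists of edges commute up to `I` to the power of minus a bilinear linking number, `listLinking`.

**Arbitrary strings.** A string operator on a simple path commutes with all plaquette operators, so
its quotient by the product of short strings along the path is a function `H` on the configurations
near the path that is invariant under adding boundaries of plaquettes. Since the path does not
overlap itself, every configuration without charges on the path is, near the path, such a boundary
(`Path.exists_plaquettes`), and therefore `H` does not notice the flips by another string that does
not end on the path. So positive string operators commute up to the same power of `I` as products of
short strings (`Path.IsStandard.comm`).

**Crossings.** Where two paths meet, the orientations of the four pairs of edges add up, modulo `4`,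
to minus the orientations that a beginning or ending common run of edges has there (`Path.turn_sum`,
which also covers paths that turn back). Every run has one beginning and one end, and the two
orientations add up to `2` if the paths cross over the run and to `0` if not. So the linking number
is twice the crossing number (`Path.listLinking_eq_two_mul`).

**Dual paths.** A dual path accompanying `P` can be pushed to the left of `P` when the other string
has no charges on `P`. Twice the number of edges of the other string that it crosses then differs
from the linking number by a telescoping sum of vertex degrees (`Path.DualRun.dualExp_eq`). So the
product of `σᶻ` along the dual path contributes another factor `(-1) ^ n`, and the whole table
follows by multiplicativity.
-/

namespace DoubleSemion

variable {L : AddSubgroup (ℤ × ℤ)}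

/-! ### Local geometry of the hexagonal lattice -/

theorem label_cases (k : ZMod 3) : k = 0 ∨ k = 1 ∨ k = 2 := by revert k; decide

/-- The unit translation `(1, 0)`. -/
abbrev unitX : Cell L := ((1, 0) : ℤ × ℤ)

/-- The unit translation `(0, 1)`. -/
abbrev unitY : Cell L := ((0, 1) : ℤ × ℤ)

@[simp] theorem shift_zero : ((offset 0 : ℤ × ℤ) : Cell L) = 0 := rfl

@[simp] theorem shift_one : ((offset 1 : ℤ × ℤ) : Cell L) = unitX := rfl

@[simp] theorem shift_two : ((offset 2 : ℤ × ℤ) : Cell L) = unitY := rfl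

/-- The plaquette at the vertex `v` for which the edge with label `m` at `v` is an outgoing edge:
the plaquette opposite to that edge. -/
def plaq (v : Vertex L) (m : ZMod 3) : Plaquette L :=
  match v with
  | (g, false) => if m = 0 then g + unitX else if m = 1 then g else g + unitX - unitY
  | (g, true) => if m = 0 then g - unitY else if m = 1 then g + unitX - unitY else g

/-- The short translations that a nondegenerate torus does not identify with zero. -/
structure Generic (L : AddSubgroup (ℤ × ℤ)) : Prop where
  x : (unitX : Cell L) ≠ 0
  y : (unitY : Cell L) ≠ 0
  xy : (unitX : Cell L) ≠ unitY
  x_add_y : (unitX : Cell L) + unitY ≠ 0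
  two_x : (unitX : Cell L) + unitX ≠ unitY
  two_y : (unitX : Cell L) ≠ unitY + unitY

theorem corner_zero (p : Plaquette L) : corner p 0 = (p, false) := rfl

theorem corner_one (p : Plaquette L) : corner p 1 = (p, true) := by
  change (p + ((offset 0 : ℤ × ℤ) : Cell L), true) = _
  simp

theorem corner_two (p : Plaquette L) : corner p 2 = (p - unitX, false) := by
  change step (corner p 1) 1 = _
  rw [corner_one]; rfl

theorem corner_three (p : Plaquette L) : corner p 3 = (p - unitX + unitY, true) := by
  change step (corner p 2) 2 = _
  rw [corner_two]; rfl

theorem corner_four (p : Plaquette L) : corner p 4 = (p - unitX + unitY, false) := by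
  change step (corner p 3) 0 = _
  rw [corner_three]
  change (p - unitX + unitY - ((offset 0 : ℤ × ℤ) : Cell L), false) = _
  simp

theorem corner_five (p : Plaquette L) : corner p 5 = (p + unitY, true) := by
  change step (corner p 4) 1 = _
  rw [corner_four]
  change (p - unitX + unitY + unitX, true) = _
  congr 1; abel

theorem corner_six (p : Plaquette L) : corner p 6 = (p, false) := by
  change step (corner p 5) 2 = _
  rw [corner_five]
  change (p + unitY - unitY, false) = _
  congr 1; abel

theorem Nondegenerate.generic (hL : Nondegenerate L) : Generic L := by
  have key : ∀ a b : ℕ, a ∈ Set.Icc 1 12 → b ∈ Set.Icc 1 12 → a ≠ b →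
      plaquetteEdge (0 : Plaquette L) a ≠ plaquetteEdge 0 b :=
    fun a b ha hb hab h => hab (hL 0 ha hb h)
  have e1 : plaquetteEdge (0 : Plaquette L) 1 = (0, 0) := rfl
  have e2 : plaquetteEdge (0 : Plaquette L) 2 = (0 - unitX, 1) := by
    change edgeOf (corner 0 1) 1 = _; rw [corner_one]; rfl
  have e8 : plaquetteEdge (0 : Plaquette L) 8 = (0 - unitX, 0) := by
    change edgeOf (corner 0 2) 0 = _; rw [corner_two]; rfl
  have e4 : plaquetteEdge (0 : Plaquette L) 4 = (0 - unitX + unitY, 0) := by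
    change edgeOf (corner 0 3) 0 = _; rw [corner_three]
    change ((0 : Plaquette L) - unitX + unitY - ((offset 0 : ℤ × ℤ) : Cell L), _) = _
    simp
  have e11 : plaquetteEdge (0 : Plaquette L) 11 = (0 + unitY, 0) := by
    change edgeOf (corner 0 5) 0 = _; rw [corner_five]
    change ((0 : Plaquette L) + unitY - ((offset 0 : ℤ × ℤ) : Cell L), _) = _
    simp
  have e9 : plaquetteEdge (0 : Plaquette L) 9 = (0 - unitX + unitY - unitX, 1) := by
    change edgeOf (corner 0 3) 1 = _; rw [corner_three]; rfl
  have e12 : plaquetteEdge (0 : Plaquette L) 12 = (0, 1) := by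
    change edgeOf (corner 0 6) 1 = _; rw [corner_six]; rfl
  have e7 : plaquetteEdge (0 : Plaquette L) 7 = (0 - unitY, 2) := by
    change edgeOf (corner 0 1) 2 = _; rw [corner_one]; rfl
  have e10 : plaquetteEdge (0 : Plaquette L) 10 = (0 - unitX + unitY, 2) := by
    change edgeOf (corner 0 4) 2 = _; rw [corner_four]; rfl
  refine ⟨fun h => ?_, fun h => ?_, fun h => ?_, fun h => ?_, fun h => ?_, fun h => ?_⟩
  · exact key 2 12 (by simp) (by simp) (by simp) (by rw [e2, e12, h]; simp)
  · exact key 1 11 (by simp) (by simp) (by simp) (by rw [e1, e11, h, add_zero])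
  · exact key 1 4 (by simp) (by simp) (by simp) (by rw [e1, e4, h, zero_sub, neg_add_cancel])
  · refine key 8 11 (by simp) (by simp) (by simp) ?_
    rw [e8, e11, zero_sub, zero_add, neg_eq_of_add_eq_zero_right h]
  · refine key 9 12 (by simp) (by simp) (by simp) ?_
    rw [e9, e12, ← h]; congr 1
  · refine key 7 10 (by simp) (by simp) (by simp) ?_
    rw [e7, e10, h]; congr 1

theorem step_step (v : Vertex L) (k : ZMod 3) : step (step v k) k = v := by
  obtain ⟨g, _ | _⟩ := v <;> simp [step]

theorem edgeOf_step (v : Vertex L) (k : ZMod 3) : edgeOf (step v k) k = edgeOf v k := by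
  obtain ⟨g, _ | _⟩ := v <;> simp [step, edgeOf]

theorem edgeOf_snd (v : Vertex L) (k : ZMod 3) : (edgeOf v k).2 = k := by
  obtain ⟨g, _ | _⟩ := v <;> rfl

theorem step_ne (v : Vertex L) (k : ZMod 3) : step v k ≠ v := by
  obtain ⟨g, _ | _⟩ := v <;> simp [step]

theorem edgeOf_eq_iff (v v' : Vertex L) (k k' : ZMod 3) :
    edgeOf v k = edgeOf v' k' ↔ k = k' ∧ (v = v' ∨ v = step v' k') := by
  constructor
  · intro h
    have hk : k = k' := by rw [← edgeOf_snd v k, h, edgeOf_snd]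
    subst hk
    refine ⟨rfl, ?_⟩
    obtain ⟨g, _ | _⟩ := v <;> obtain ⟨g', _ | _⟩ := v' <;> simp_all [step, edgeOf]
    rw [← h, sub_add_cancel]
  · rintro ⟨rfl, rfl | rfl⟩
    · rfl
    · exact edgeOf_step _ _

theorem edgeOf_injective (v : Vertex L) : Function.Injective (edgeOf v) := fun k k' h => by
  rw [← edgeOf_snd v k, h, edgeOf_snd]

/-- Two cells that differ by one of the short translations are different. -/
theorem Generic.ne_of_sub (hL : Generic L) {a b : Cell L}
    (h : a - b ∈ ({unitX, unitY, unitX - unitY, unitX + unitY, unitX + unitX - unitY,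
      unitX - unitY - unitY} : Set (Cell L))) : a ≠ b := by
  rintro rfl
  simp only [sub_self, Set.mem_insert_iff, Set.mem_singleton_iff] at h
  rcases h with h | h | h | h | h | h
  · exact hL.x h.symm
  · exact hL.y h.symm
  · exact hL.xy (sub_eq_zero.mp h.symm)
  · exact hL.x_add_y h.symm
  · exact hL.two_x (sub_eq_zero.mp h.symm)
  · exact hL.two_y (sub_eq_zero.mp (by rw [h]; abel))

theorem Generic.step_injective (hL : Generic L) (v : Vertex L) :
    Function.Injective (step v) := by
  have off : ∀ k k' : ZMod 3, ((offset k : ℤ × ℤ) : Cell L) = ((offset k' : ℤ × ℤ) : Cell L) →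
      k = k' := by
    have hx := hL.x; have hy := hL.y; have hxy := hL.xy
    intro k k' h
    rcases label_cases k with rfl | rfl | rfl <;> rcases label_cases k' with rfl | rfl | rfl <;>
      first
      | rfl
      | exact absurd h hx
      | exact absurd h.symm hx
      | exact absurd h hy
      | exact absurd h.symm hy
      | exact absurd h hxy
      | exact absurd h.symm hxy
  intro k k' h
  obtain ⟨g, _ | _⟩ := v
  · exact off k k' (by simpa [step] using h)
  · exact off k k' (by simpa [step] using h)

theorem Generic.plaq_injective (hL : Generic L) (v : Vertex L) :
    Function.Injective (plaq v) := by
  have h3 : (2 : ZMod 3) ≠ 0 := by decide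
  have h4 : (2 : ZMod 3) ≠ 1 := by decide
  intro k k' h
  obtain ⟨g, _ | _⟩ := v <;>
  rcases label_cases k with rfl | rfl | rfl <;> rcases label_cases k' with rfl | rfl | rfl <;>
    simp only [plaq, h3, h4, if_true, if_false, one_ne_zero] at h <;>
    first
    | rfl
    | (exfalso
       first
       | (refine hL.ne_of_sub (.inl ?_) h; abel1)
       | (refine hL.ne_of_sub (.inr (.inl ?_)) h; abel1)
       | (refine hL.ne_of_sub (.inr (.inr (.inl ?_))) h; abel1)
       | (refine hL.ne_of_sub (.inl ?_) h.symm; abel1)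
       | (refine hL.ne_of_sub (.inr (.inl ?_)) h.symm; abel1)
       | (refine hL.ne_of_sub (.inr (.inr (.inl ?_))) h.symm; abel1))

/-- The plaquette to the left of a directed edge, seen from both of its ends. -/
theorem plaq_step_add (v : Vertex L) (k : ZMod 3) : plaq (step v k) (k + 1) = plaq v (k - 1) := by
  have h11 : (1 + 1 : ZMod 3) = 2 := rfl
  have h21 : (2 + 1 : ZMod 3) = 0 := rfl
  have h22 : (2 - 1 : ZMod 3) = 1 := rfl
  have h01 : (-1 : ZMod 3) = 2 := rfl
  have h3 : (2 : ZMod 3) ≠ 0 := by decide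
  have h4 : (2 : ZMod 3) ≠ 1 := by decide
  obtain ⟨g, _ | _⟩ := v <;> rcases label_cases k with rfl | rfl | rfl <;>
    simp [step, plaq, h11, h21, h22, h01, h3, h4]
  abel

theorem plaq_step_sub (v : Vertex L) (k : ZMod 3) : plaq (step v k) (k - 1) = plaq v (k + 1) := by
  have := plaq_step_add (step v k) k
  rw [step_step] at this
  exact this.symm

/-- The plaquette opposite to an edge at one end does not touch the other end. -/
theorem Generic.plaq_step_ne (hL : Generic L) (v : Vertex L) (k m : ZMod 3) :
    plaq (step v k) k ≠ plaq v m := by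
  intro h
  have h3 : (2 : ZMod 3) ≠ 0 := by decide
  have h4 : (2 : ZMod 3) ≠ 1 := by decide
  obtain ⟨g, _ | _⟩ := v <;>
  rcases label_cases k with rfl | rfl | rfl <;> rcases label_cases m with rfl | rfl | rfl <;>
    simp only [plaq, step, shift_zero, shift_one, shift_two, h3, h4, if_true, if_false,
      one_ne_zero, add_zero, sub_zero] at h <;>
    first
    | (refine hL.ne_of_sub (.inl ?_) h; abel1)
    | (refine hL.ne_of_sub (.inl ?_) h.symm; abel1)
    | (refine hL.ne_of_sub (.inr (.inl ?_)) h; abel1)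
    | (refine hL.ne_of_sub (.inr (.inl ?_)) h.symm; abel1)
    | (refine hL.ne_of_sub (.inr (.inr (.inl ?_))) h; abel1)
    | (refine hL.ne_of_sub (.inr (.inr (.inl ?_))) h.symm; abel1)
    | (refine hL.ne_of_sub (.inr (.inr (.inr (.inl ?_)))) h; abel1)
    | (refine hL.ne_of_sub (.inr (.inr (.inr (.inl ?_)))) h.symm; abel1)
    | (refine hL.ne_of_sub (.inr (.inr (.inr (.inr (.inl ?_))))) h; abel1)
    | (refine hL.ne_of_sub (.inr (.inr (.inr (.inr (.inl ?_))))) h.symm; abel1)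
    | (refine hL.ne_of_sub (.inr (.inr (.inr (.inr (.inr
        (Set.mem_singleton_iff.mpr ?_)))))) h; abel1)
    | (refine hL.ne_of_sub (.inr (.inr (.inr (.inr (.inr
        (Set.mem_singleton_iff.mpr ?_)))))) h.symm; abel1)

/-- The corner of the plaquette `p` in the sublattice `s` whose outgoing edge has label `m`. -/
def cornerAt (p : Plaquette L) (s : Bool) (m : ZMod 3) : Vertex L :=
  (match s with
    | false => if m = 0 then p - unitX else if m = 1 then p else p - unitX + unitY
    | true => if m = 0 then p + unitY else if m = 1 then p - unitX + unitY else p, s)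

theorem cornerAt_eq_iff (p : Plaquette L) (s : Bool) (m : ZMod 3) (v : Vertex L) :
    cornerAt p s m = v ↔ s = v.2 ∧ plaq v m = p := by
  obtain ⟨g, t⟩ := v
  have h3 : (2 : ZMod 3) ≠ 0 := by decide
  have h4 : (2 : ZMod 3) ≠ 1 := by decide
  have aux : ∀ a b : Cell L, a + b = 0 → (a = 0 ↔ b = 0) := by
    intro a b h; rw [eq_neg_of_add_eq_zero_left h, neg_eq_zero]
  cases s <;> cases t <;> rcases label_cases m with rfl | rfl | rfl <;>
    simp only [cornerAt, plaq, h3, h4, if_true, if_false, one_ne_zero, Prod.mk.injEq, and_true,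
      true_and, and_false, false_and, reduceCtorEq] <;>
    rw [← sub_eq_zero, ← sub_eq_zero (b := p)] <;> apply aux <;> abel

theorem corners_eq (p : Plaquette L) :
    corners p = Set.range (fun sm : Bool × ZMod 3 => cornerAt p sm.1 sm.2) := by
  have h3 : (2 : ZMod 3) ≠ 0 := by decide
  have h4 : (2 : ZMod 3) ≠ 1 := by decide
  ext v
  constructor
  · rintro ⟨j, hj, rfl⟩
    have hj : j < 6 := hj
    interval_cases j
    · exact ⟨(false, 1), by simp [cornerAt, corner_zero]⟩
    · exact ⟨(true, 2), by simp [cornerAt, corner_one, h3, h4]⟩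
    · exact ⟨(false, 0), by simp [cornerAt, corner_two]⟩
    · exact ⟨(true, 1), by simp [cornerAt, corner_three]⟩
    · exact ⟨(false, 2), by simp [cornerAt, corner_four, h3, h4]⟩
    · exact ⟨(true, 0), by simp [cornerAt, corner_five]⟩
  · rintro ⟨⟨_ | _, m⟩, rfl⟩ <;> rcases label_cases m with rfl | rfl | rfl
    · exact ⟨2, by simp, by simp [cornerAt, corner_two]⟩
    · exact ⟨0, by simp, by simp [cornerAt, corner_zero]⟩
    · exact ⟨4, by simp, by simp [cornerAt, corner_four, h3, h4]⟩
    · exact ⟨5, by simp, by simp [cornerAt, corner_five]⟩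
    · exact ⟨3, by simp, by simp [cornerAt, corner_three]⟩
    · exact ⟨1, by simp, by simp [cornerAt, corner_one, h3, h4]⟩

theorem mem_corners_iff (p : Plaquette L) (v : Vertex L) :
    v ∈ corners p ↔ ∃ m, plaq v m = p := by
  simp only [corners_eq, Set.mem_range, Prod.exists, cornerAt_eq_iff]
  constructor
  · rintro ⟨_, m, -, h⟩; exact ⟨m, h⟩
  · rintro ⟨m, h⟩; exact ⟨v.2, m, rfl, h⟩

theorem mem_boundary_iff_exists (p : Plaquette L) (e : Edge L) :
    e ∈ boundary p ↔ ∃ s m k, m ≠ k ∧ e = edgeOf (cornerAt p s m) k := by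
  have c0 : cornerAt p false 1 = corner p 0 := rfl
  have c1 : cornerAt p true 2 = corner p 1 := (corner_one p).symm
  have c2 : cornerAt p false 0 = corner p 2 := (corner_two p).symm
  have c3 : cornerAt p true 1 = corner p 3 := (corner_three p).symm
  have c4 : cornerAt p false 2 = corner p 4 := (corner_four p).symm
  have c5 : cornerAt p true 0 = corner p 5 := (corner_five p).symm
  have c6 : cornerAt p false 1 = corner p 6 := (corner_six p).symm
  constructor
  · rintro ⟨j, ⟨h1, h6⟩, rfl⟩
    interval_cases j
    · exact ⟨false, 1, 0, by decide, by rw [c0]; rfl⟩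
    · exact ⟨true, 2, 1, by decide, by rw [c1]; rfl⟩
    · exact ⟨false, 0, 2, by decide, by rw [c2]; rfl⟩
    · exact ⟨true, 1, 0, by decide, by rw [c3]; rfl⟩
    · exact ⟨false, 2, 1, by decide, by rw [c4]; rfl⟩
    · exact ⟨true, 0, 2, by decide, by rw [c5]; rfl⟩
  · have p1 : plaquetteEdge p 1 = edgeOf (corner p 0) 0 := rfl
    have p2 : plaquetteEdge p 2 = edgeOf (corner p 1) 1 := rfl
    have p3 : plaquetteEdge p 3 = edgeOf (corner p 2) 2 := rfl
    have p4 : plaquetteEdge p 4 = edgeOf (corner p 3) 0 := rfl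
    have p5 : plaquetteEdge p 5 = edgeOf (corner p 4) 1 := rfl
    have p6 : plaquetteEdge p 6 = edgeOf (corner p 5) 2 := rfl
    rintro ⟨_ | _, m, k, hmk, rfl⟩ <;> rcases label_cases m with rfl | rfl | rfl <;>
      rcases label_cases k with rfl | rfl | rfl <;> first | exact absurd rfl hmk | skip
    · exact ⟨2, by simp, by rw [p2, c2, ← edgeOf_step]; rfl⟩
    · exact ⟨3, by simp, by rw [p3, c2]⟩
    · exact ⟨1, by simp, by rw [p1, c0]⟩
    · exact ⟨6, by simp, by rw [p6, c6, ← edgeOf_step]; rfl⟩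
    · exact ⟨4, by simp, by rw [p4, c4, ← edgeOf_step]; rfl⟩
    · exact ⟨5, by simp, by rw [p5, c4]⟩
    · exact ⟨5, by simp, by rw [p5, c5, ← edgeOf_step]; rfl⟩
    · exact ⟨6, by simp, by rw [p6, c5]⟩
    · exact ⟨4, by simp, by rw [p4, c3]⟩
    · exact ⟨3, by simp, by rw [p3, c3, ← edgeOf_step]; rfl⟩
    · exact ⟨1, by simp, by rw [p1, c1, ← edgeOf_step]; rfl⟩
    · exact ⟨2, by simp, by rw [p2, c1]⟩

theorem edgeOf_mem_boundary_iff (p : Plaquette L) (v : Vertex L) (k : ZMod 3) :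
    edgeOf v k ∈ boundary p ↔ ∃ m, m ≠ k ∧ plaq v m = p := by
  rw [mem_boundary_iff_exists]
  constructor
  · rintro ⟨s, m, k', hmk, h⟩
    obtain ⟨rfl, hv⟩ := (edgeOf_eq_iff _ _ _ _).mp h
    have hc := ((cornerAt_eq_iff p s m _).mp rfl).2
    rcases hv with rfl | rfl
    · exact ⟨m, hmk, hc⟩
    · -- passing to the other end of the edge exchanges the labels `k + 1` and `k - 1`
      have : m = k + 1 ∨ m = k - 1 := by clear hc h; revert m k; decide
      rcases this with rfl | rfl
      · exact ⟨k - 1, by simp, by rw [plaq_step_sub, hc]⟩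
      · exact ⟨k + 1, by simp, by rw [plaq_step_add, hc]⟩
  · rintro ⟨m, hmk, rfl⟩
    exact ⟨v.2, m, k, hmk, by rw [(cornerAt_eq_iff _ _ _ v).mpr ⟨rfl, rfl⟩]⟩

/-! ### Phases as exponents of the imaginary unit -/

/-- The fourth root of unity `I ^ z`. -/
noncomputable def phase (z : ZMod 4) : ℂ := Complex.I ^ z.val

theorem phase_natCast (n : ℕ) : phase n = Complex.I ^ n := by
  rw [phase, ZMod.val_natCast]
  conv_rhs => rw [← Nat.div_add_mod n 4, pow_add, pow_mul, Complex.I_pow_four, one_pow, one_mul]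

@[simp] theorem phase_zero : phase 0 = 1 := by simpa using phase_natCast 0

theorem phase_add (x y : ZMod 4) : phase (x + y) = phase x * phase y := by
  rw [← ZMod.natCast_zmod_val x, ← ZMod.natCast_zmod_val y, ← Nat.cast_add, phase_natCast,
    phase_natCast, phase_natCast, pow_add]

theorem phase_neg (x : ZMod 4) : phase (-x) = (phase x)⁻¹ := by
  refine eq_inv_of_mul_eq_one_left ?_
  rw [← phase_add, neg_add_cancel, phase_zero]

theorem phase_intCast (n : ℤ) : phase n = Complex.I ^ n := by
  obtain ⟨m, rfl | rfl⟩ := n.eq_nat_or_neg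
  · simpa using phase_natCast m
  · rw [Int.cast_neg, phase_neg, zpow_neg]
    simpa using phase_natCast m

theorem phase_two_mul_intCast (n : ℤ) : phase (2 * n) = (-1) ^ n := by
  have := phase_intCast (2 * n)
  rw [zpow_mul] at this
  push_cast at this
  rw [this]
  simp

theorem phase_two_mul_natCast (n : ℕ) : phase (2 * n) = (-1) ^ n := by
  simpa using phase_two_mul_intCast n

/-! ### The exponent of the plaquette phase -/

/-- The number `0` or `1` as an exponent of the imaginary unit. -/
def lift (a : ZMod 2) : ZMod 4 := (a.val : ZMod 4)

/-- The occupations of the three edges at the vertex `v`. -/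
def loc (i : Config L) (v : Vertex L) : ZMod 3 → ZMod 2 := fun k => i (edgeOf v k)

/-- The contribution to the exponent of `plaquettePhase` of the corner whose outgoing edge has
label `m`, as a function of the occupations at this corner. -/
def cornerExp (m : ZMod 3) (x : ZMod 3 → ZMod 2) : ZMod 4 :=
  let l := lift (x m)
  let a := lift (x (m + 1))
  let b := lift (x (m + 2))
  2 * (a * (1 - b)) +
    if m = 1 then l * (a * b - (1 - a) * (1 - b))
    else if m = 2 then l * ((1 - a) * (1 - b) - a * b)
    else (1 - l) * (a * (1 - b) - (1 - a) * b)

/-- The exponent of `plaquettePhase`. -/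
def plaqExp (p : Plaquette L) (i : Config L) : ZMod 4 :=
  ∑ s : Bool, ∑ m : ZMod 3, cornerExp m (loc i (cornerAt p s m))

theorem plaquetteEdge_eq (p : Plaquette L) :
    plaquetteEdge p 1 = edgeOf (cornerAt p false 1) 0 ∧
    plaquetteEdge p 1 = edgeOf (cornerAt p true 2) 0 ∧
    plaquetteEdge p 2 = edgeOf (cornerAt p true 2) 1 ∧
    plaquetteEdge p 2 = edgeOf (cornerAt p false 0) 1 ∧
    plaquetteEdge p 3 = edgeOf (cornerAt p false 0) 2 ∧
    plaquetteEdge p 3 = edgeOf (cornerAt p true 1) 2 ∧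
    plaquetteEdge p 4 = edgeOf (cornerAt p true 1) 0 ∧
    plaquetteEdge p 4 = edgeOf (cornerAt p false 2) 0 ∧
    plaquetteEdge p 5 = edgeOf (cornerAt p false 2) 1 ∧
    plaquetteEdge p 5 = edgeOf (cornerAt p true 0) 1 ∧
    plaquetteEdge p 6 = edgeOf (cornerAt p true 0) 2 ∧
    plaquetteEdge p 6 = edgeOf (cornerAt p false 1) 2 ∧
    plaquetteEdge p 7 = edgeOf (cornerAt p true 2) 2 ∧
    plaquetteEdge p 8 = edgeOf (cornerAt p false 0) 0 ∧
    plaquetteEdge p 9 = edgeOf (cornerAt p true 1) 1 ∧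
    plaquetteEdge p 10 = edgeOf (cornerAt p false 2) 2 ∧
    plaquetteEdge p 11 = edgeOf (cornerAt p true 0) 0 ∧
    plaquetteEdge p 12 = edgeOf (cornerAt p false 1) 1 := by
  have c0 : cornerAt p false 1 = corner p 0 := rfl
  have c1 : cornerAt p true 2 = corner p 1 := (corner_one p).symm
  have c2 : cornerAt p false 0 = corner p 2 := (corner_two p).symm
  have c3 : cornerAt p true 1 = corner p 3 := (corner_three p).symm
  have c4 : cornerAt p false 2 = corner p 4 := (corner_four p).symm
  have c5 : cornerAt p true 0 = corner p 5 := (corner_five p).symm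
  have c6 : corner p 0 = corner p 6 := (corner_six p).symm
  rw [c0, c1, c2, c3, c4, c5]
  refine ⟨rfl, ?_, rfl, ?_, rfl, ?_, rfl, ?_, rfl, ?_, rfl, ?_, rfl, rfl, rfl, rfl, rfl, ?_⟩
  · exact (edgeOf_step (corner p 0) 0).symm
  · exact (edgeOf_step (corner p 1) 1).symm
  · exact (edgeOf_step (corner p 2) 2).symm
  · exact (edgeOf_step (corner p 3) 0).symm
  · exact (edgeOf_step (corner p 4) 1).symm
  · rw [c6]; exact (edgeOf_step (corner p 5) 2).symm
  · rw [c6]; rfl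

theorem plaquettePhase_eq (p : Plaquette L) (i : Config L) :
    plaquettePhase p i = phase (plaqExp p i) := by
  have h3 : (0 : ZMod 3) ≠ 2 := by decide
  have h4 : (2 : ZMod 3) ≠ 1 := by decide
  have h5 : (1 + 1 : ZMod 3) = 2 := rfl
  have h6 : (1 + 2 : ZMod 3) = 0 := rfl
  have h7 : (2 + 1 : ZMod 3) = 0 := rfl
  have h8 : (2 + 2 : ZMod 3) = 1 := rfl
  obtain ⟨e1, e1', e2, e2', e3, e3', e4, e4', e5, e5', e6, e6', e7, e8, e9, e10, e11, e12⟩ :=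
    plaquetteEdge_eq p
  simp only [plaquettePhase, ← phase_two_mul_intCast, ← phase_intCast, ← phase_add]
  congr 1
  have hn : ∀ j, (nMinus p i j : ZMod 4) = lift (i (plaquetteEdge p j)) := fun j => by
    simp [nMinus, lift]
  simp only [nPlus]
  push_cast
  simp only [hn]
  have h3s : ∀ f : ZMod 3 → ZMod 4, ∑ m, f m = f 0 + f 1 + f 2 := fun f => Fin.sum_univ_three f
  simp only [plaqExp, Fintype.sum_bool, h3s, cornerExp, loc, zero_add, h3, h4, h5, h6, h7, h8,
    if_true, if_false, zero_ne_one, ← e1, ← e1', ← e2, ← e2', ← e3, ← e3', ← e4, ← e4',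
    ← e5, ← e5', ← e6, ← e6', ← e7, ← e8, ← e9, ← e10, ← e11, ← e12]
  ring

/-! ### Flipping edges and plaquettes -/

/-- The configuration occupied on the edge `e` only. -/
noncomputable def single (e : Edge L) : Config L := by
  classical exact Pi.single e 1

/-- The configuration occupied on the boundary of the plaquette `p`. -/
noncomputable abbrev plaqConfig (p : Plaquette L) : Config L := occupied (boundary p)

open Classical in
theorem plaqConfig_apply (p : Plaquette L) (v : Vertex L) (k : ZMod 3) :
    plaqConfig p (edgeOf v k) = if ∃ m, m ≠ k ∧ plaq v m = p then 1 else 0 := by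
  have : plaqConfig p (edgeOf v k) = if edgeOf v k ∈ boundary p then 1 else 0 := rfl
  simp only [this, edgeOf_mem_boundary_iff]

theorem loc_add (i j : Config L) (v : Vertex L) : loc (i + j) v = loc i v + loc j v := rfl

open Classical in
theorem loc_single (v w : Vertex L) (k : ZMod 3) :
    loc (single (edgeOf w k)) v = if v = w ∨ v = step w k then Pi.single k 1 else 0 := by
  funext k'
  simp only [loc, single, Pi.single_apply, edgeOf_eq_iff]
  split_ifs with h1 h2 h2
  · rw [h1.1]; simp
  · exact absurd h1.2 h2
  · rw [Pi.single_apply, if_neg]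
    rintro rfl; exact h1 ⟨rfl, h2⟩
  · rfl

/-- The two edges at a vertex that bound the plaquette opposite to the edge with label `m`. -/
def pair (m : ZMod 3) : ZMod 3 → ZMod 2 := fun k => if k = m then 0 else 1

theorem Generic.loc_plaqConfig (hL : Generic L) (v : Vertex L) (m : ZMod 3) :
    loc (plaqConfig (plaq v m)) v = pair m := by
  funext k
  rw [loc, plaqConfig_apply, pair]
  by_cases h : k = m
  · rw [if_pos h, if_neg]
    rintro ⟨m', hm', h'⟩
    exact hm' ((hL.plaq_injective v h').trans h.symm)
  · rw [if_neg h, if_pos ⟨m, fun h' => h h'.symm, rfl⟩]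

theorem loc_plaqConfig_of_ne {v : Vertex L} {p : Plaquette L} (h : ∀ m, plaq v m ≠ p) :
    loc (plaqConfig p) v = 0 := by
  funext k
  rw [loc, plaqConfig_apply]
  exact if_neg fun ⟨m, _, hm⟩ => h m hm

/-! ### Short strings -/

/-- The contribution of one end of an edge with label `k` to the exponent of the short string
operator on this edge, as a function of the occupations at this end. The requirement that the
operator commutes with the plaquette operators (`Generic.edgeExp_add_plaqConfig`) determines the
sum over both ends up to a function of the two charges. This function is chosen such that two short
string operators commute up to a constant phase (`endExp_comm`). -/
def endExp (k : ZMod 3) (x : ZMod 3 → ZMod 2) : ZMod 4 :=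
  let e := lift (x k)
  let a := lift (x (k + 1))
  let b := lift (x (k + 2))
  3 * (a * b) + 2 * (e * a * b) +
    if k = 0 then a + 2 * (e * b)
    else if k = 1 then 2 * a + 2 * b + 2 * (e * a) + 2 * (e * b)
    else 3 * a + 3 * b

/-- The exponent of the phase of the short string operator on the edge `e`. -/
def edgeExp (e : Edge L) (i : Config L) : ZMod 4 :=
  endExp e.2 (loc i (e.1, false)) + endExp e.2 (loc i (step (e.1, false) e.2)) - lift (i e)

theorem edgeExp_edgeOf (v : Vertex L) (k : ZMod 3) (i : Config L) :
    edgeExp (edgeOf v k) i =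
      endExp k (loc i v) + endExp k (loc i (step v k)) - lift (loc i v k) := by
  obtain ⟨g, _ | _⟩ := v
  · rfl
  · have : edgeOf (g, true) k = (((g - (offset k : Cell L)) , k) : Edge L) := rfl
    rw [this, edgeExp]
    have h2 : ((g - (offset k : Cell L), false) : Vertex L) = step (g, true) k := rfl
    simp only
    rw [h2, step_step, loc, this]
    ring

/-- The orientation of two labels at a vertex: `1` if the second is the next counterclockwise after
the first, `-1` if it is the next clockwise and `0` if they agree. -/
def turn (k k' : ZMod 3) : ZMod 4 := if k' = k + 1 then 1 else if k' = k - 1 then -1 else 0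

/-- Moving two strings past each other at a vertex picks up their orientation. -/
theorem endExp_comm : ∀ (k k' : ZMod 3) (x : ZMod 3 → ZMod 2),
    endExp k (x + Pi.single k' 1) + endExp k' x =
      endExp k' (x + Pi.single k 1) + endExp k x - turn k k' := by
  decide

/-- The plaquette opposite to the edge. -/
theorem endExp_pair_self : ∀ (k : ZMod 3) (x : ZMod 3 → ZMod 2),
    endExp k (x + pair k) - endExp k x = cornerExp k (x + Pi.single k 1) - cornerExp k x := by
  decide

/-- The plaquette that contains the edges with labels `k` and `k - 1` at this end. The defect, the
last two terms, splits into the change of the occupation of the edge, and a constant that the other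
end of the edge (`endExp_pair_sub_one`) compensates. -/
theorem endExp_pair_add_one : ∀ (k : ZMod 3) (x : ZMod 3 → ZMod 2),
    endExp k (x + pair (k + 1)) - endExp k x =
      cornerExp (k + 1) (x + Pi.single k 1) - cornerExp (k + 1) x
        + (lift (x k + 1) - lift (x k)) + (if k = 0 then 1 else -1) := by
  decide

/-- The plaquette that contains the edges with labels `k` and `k + 1` at this end. -/
theorem endExp_pair_sub_one : ∀ (k : ZMod 3) (x : ZMod 3 → ZMod 2),
    endExp k (x + pair (k - 1)) - endExp k x =
      cornerExp (k - 1) (x + Pi.single k 1) - cornerExp (k - 1) x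
        - (if k = 0 then 1 else -1) := by
  decide

/-- The change of the exponent of the phase of the plaquette `p` at its corner `v`, if it is one,
when the edge with label `k` at `v` is flipped. -/
noncomputable def cornerDiff (p : Plaquette L) (v : Vertex L) (k : ZMod 3)
    (x : ZMod 3 → ZMod 2) : ZMod 4 := by
  classical exact
    ∑ m, if plaq v m = p then cornerExp m (x + Pi.single k 1) - cornerExp m x else 0

theorem plaqExp_add_single (p : Plaquette L) (v : Vertex L) (k : ZMod 3) (i : Config L) :
    plaqExp p (i + single (edgeOf v k)) - plaqExp p i =
      cornerDiff p v k (loc i v) + cornerDiff p (step v k) k (loc i (step v k)) := by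
  classical
  have hne : (step v k).2 ≠ v.2 := by obtain ⟨g, _ | _⟩ := v <;> simp [step]
  have term : ∀ (s : Bool) (m : ZMod 3), cornerExp m (loc (i + single (edgeOf v k)) (cornerAt p s m))
      - cornerExp m (loc i (cornerAt p s m)) =
      (if s = v.2 then (if plaq v m = p then
        cornerExp m (loc i v + Pi.single k 1) - cornerExp m (loc i v) else 0) else 0) +
      (if s = (step v k).2 then (if plaq (step v k) m = p then
        cornerExp m (loc i (step v k) + Pi.single k 1) - cornerExp m (loc i (step v k)) else 0)
        else 0) := by
    intro s m
    rw [loc_add, loc_single]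
    by_cases h1 : cornerAt p s m = v
    · obtain ⟨h3, h4⟩ := (cornerAt_eq_iff _ _ _ _).mp h1
      rw [if_pos (Or.inl h1), h1, if_pos h3, if_pos h4, if_neg (h3 ▸ hne.symm), add_zero]
    · by_cases h2 : cornerAt p s m = step v k
      · obtain ⟨h3, h4⟩ := (cornerAt_eq_iff _ _ _ _).mp h2
        rw [if_pos (Or.inr h2), h2, if_pos h3, if_pos h4, if_neg (h3 ▸ hne), zero_add]
      · rw [if_neg (by tauto), add_zero, sub_self]
        rw [cornerAt_eq_iff] at h1 h2
        simp only [← ite_and]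
        rw [if_neg h1, if_neg h2, add_zero]
  rw [plaqExp, plaqExp, ← Finset.sum_sub_distrib]
  simp only [← Finset.sum_sub_distrib, term, Finset.sum_add_distrib]
  congr 1
  · rw [Finset.sum_comm]
    exact Finset.sum_congr rfl fun m _ => by simp
  · rw [Finset.sum_comm]
    exact Finset.sum_congr rfl fun m _ => by simp

theorem Generic.cornerDiff_plaq (hL : Generic L) (v : Vertex L) (m k : ZMod 3)
    (x : ZMod 3 → ZMod 2) :
    cornerDiff (plaq v m) v k x = cornerExp m (x + Pi.single k 1) - cornerExp m x := by
  classical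
  rw [cornerDiff, Finset.sum_eq_single m]
  · rw [if_pos rfl]
  · exact fun m' _ h => if_neg fun h' => h (hL.plaq_injective v h')
  · simp

theorem cornerDiff_of_ne {p : Plaquette L} {v : Vertex L} (h : ∀ m, plaq v m ≠ p) (k : ZMod 3)
    (x : ZMod 3 → ZMod 2) : cornerDiff p v k x = 0 := by
  classical
  exact Finset.sum_eq_zero fun m _ => if_neg (h m)

/-- The short string operators commute with all plaquette operators. -/
theorem Generic.edgeExp_add_plaqConfig (hL : Generic L) (e : Edge L) (p : Plaquette L)
    (i : Config L) :
    edgeExp e (i + plaqConfig p) - edgeExp e i = plaqExp p (i + single e) - plaqExp p i := by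
  obtain ⟨v, k, rfl⟩ : ∃ v k, e = edgeOf v k := ⟨(e.1, false), e.2, rfl⟩
  have hshare : loc i (step v k) k = loc i v k := congrArg i (edgeOf_step v k)
  rw [plaqExp_add_single, edgeExp_edgeOf, edgeExp_edgeOf, loc_add, loc_add]
  have hcases : ∀ m, m = k ∨ m = k + 1 ∨ m = k - 1 := by clear hshare; revert k; decide
  have hk : k ≠ k + 1 := by simp
  have hk' : k ≠ k - 1 := (by decide : ∀ k : ZMod 3, k ≠ k - 1) k
  by_cases hv : ∃ m, plaq v m = p
  · obtain ⟨m, rfl⟩ := hv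
    rw [hL.loc_plaqConfig, hL.cornerDiff_plaq]
    rcases hcases m with rfl | rfl | rfl
    · have hne : ∀ m', plaq (step v m) m' ≠ plaq v m := fun m' h => by
        have := hL.plaq_step_ne (step v m) m m'
        rw [step_step] at this
        exact this h.symm
      rw [loc_plaqConfig_of_ne hne, cornerDiff_of_ne hne, add_zero]
      have h0 : (loc i v + pair m) m = loc i v m := by simp [pair]
      rw [h0]
      linear_combination endExp_pair_self m (loc i v)
    · rw [← plaq_step_sub, hL.loc_plaqConfig, hL.cornerDiff_plaq]
      have h0 : (loc i v + pair (k + 1)) k = loc i v k + 1 := by simp [pair]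
      rw [h0]
      linear_combination endExp_pair_add_one k (loc i v) +
        endExp_pair_sub_one k (loc i (step v k))
    · rw [← plaq_step_add, hL.loc_plaqConfig, hL.cornerDiff_plaq]
      have h0 : (loc i v + pair (k - 1)) k = loc i v k + 1 := by simp [pair, hk']
      rw [h0, ← hshare]
      linear_combination endExp_pair_sub_one k (loc i v) +
        endExp_pair_add_one k (loc i (step v k))
  · push Not at hv
    rw [loc_plaqConfig_of_ne hv, cornerDiff_of_ne hv, add_zero, zero_add]
    by_cases hw : ∃ m, plaq (step v k) m = p
    · obtain ⟨m, rfl⟩ := hw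
      rw [hL.loc_plaqConfig, hL.cornerDiff_plaq]
      rcases hcases m with rfl | rfl | rfl
      · linear_combination endExp_pair_self m (loc i (step v m))
      · exact absurd (plaq_step_add v k).symm (hv _)
      · exact absurd (plaq_step_sub v k).symm (hv _)
    · push Not at hw
      rw [loc_plaqConfig_of_ne hw, cornerDiff_of_ne hw, add_zero]
      ring

/-! ### Commuting short strings -/

/-- The difference of `N` on the two neighbours of the edge with label `k` around the vertex `v`. -/
def around (N : Edge L → ZMod 4) (v : Vertex L) (k : ZMod 3) : ZMod 4 :=
  N (edgeOf v (k + 1)) - N (edgeOf v (k - 1))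

/-- The signed number of edges, counted with multiplicities `N`, that share a vertex with the edge
`e`; they count positively if they come next after `e` counterclockwise, and negatively if they come
next clockwise. -/
def linking (N : Edge L → ZMod 4) (e : Edge L) : ZMod 4 :=
  around N (e.1, false) e.2 + around N (step (e.1, false) e.2) e.2

theorem linking_edgeOf (N : Edge L → ZMod 4) (v : Vertex L) (k : ZMod 3) :
    linking N (edgeOf v k) = around N v k + around N (step v k) k := by
  obtain ⟨g, _ | _⟩ := v
  · rfl
  · have h2 : (((edgeOf (g, true) k : Edge L).1, false) : Vertex L) = step (g, true) k := rfl
    rw [linking, h2, edgeOf_snd, step_step, add_comm]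

theorem linking_add (N N' : Edge L → ZMod 4) (e : Edge L) :
    linking (N + N') e = linking N e + linking N' e := by
  simp only [linking, around, Pi.add_apply]; ring

theorem linking_zero (e : Edge L) : linking 0 e = 0 := by simp [linking, around]

/-- The multiplicity function of a single edge. -/
noncomputable def indicator (f : Edge L) : Edge L → ZMod 4 := by
  classical exact Pi.single f 1

open Classical in
theorem indicator_apply (f e : Edge L) : indicator f e = if e = f then 1 else 0 := by
  rw [indicator, Pi.single_apply]

theorem around_indicator_self (v : Vertex L) (k k' : ZMod 3) :
    around (indicator (edgeOf v k')) v k = turn k k' := by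
  have : ∀ m, edgeOf v m = edgeOf v k' ↔ k' = m := fun m =>
    (edgeOf_injective v).eq_iff.trans eq_comm
  rw [around, indicator_apply, indicator_apply, turn]
  simp only [this]
  have h : k + 1 ≠ k - 1 := (by decide : ∀ k : ZMod 3, k + 1 ≠ k - 1) k
  split_ifs with h1 h2 h2
  · exact absurd (h1.symm.trans h2) h
  · simp
  · simp
  · simp

theorem around_indicator_of_ne {v w : Vertex L} {k' : ZMod 3} (h : v ≠ w) (h' : v ≠ step w k')
    (k : ZMod 3) : around (indicator (edgeOf w k')) v k = 0 := by
  rw [around, indicator_apply, indicator_apply, if_neg, if_neg, sub_self]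
  · rw [edgeOf_eq_iff]; tauto
  · rw [edgeOf_eq_iff]; tauto

theorem turn_self : ∀ k, turn k k = 0 := by decide

theorem Generic.edgeExp_comm_of_ne (hL : Generic L) (v : Vertex L) {k k' : ZMod 3} (hk : k ≠ k')
    (i : Config L) :
    edgeExp (edgeOf v k) (i + single (edgeOf v k')) + edgeExp (edgeOf v k') i =
      edgeExp (edgeOf v k') (i + single (edgeOf v k)) + edgeExp (edgeOf v k) i
        - linking (indicator (edgeOf v k')) (edgeOf v k) := by
  have h1 : step v k ≠ step v k' := fun h => hk (hL.step_injective v h)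
  have h2 := step_ne v k
  have h2' := step_ne v k'
  rw [linking_edgeOf, around_indicator_self, around_indicator_of_ne h2 h1]
  simp only [edgeExp_edgeOf, loc_add, loc_single, true_or, if_true, h2, h2', h1, h1.symm, or_self,
    if_false, add_zero, Pi.add_apply, Pi.single_eq_of_ne hk, Pi.single_eq_of_ne hk.symm]
  linear_combination endExp_comm k k' (loc i v)

/-- Exchanging two short string operators costs a power of the imaginary unit, whose exponent is
their orientation at a common vertex. -/
theorem Generic.edgeExp_comm (hL : Generic L) (e f : Edge L) (i : Config L) :
    edgeExp e (i + single f) + edgeExp f i =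
      edgeExp f (i + single e) + edgeExp e i - linking (indicator f) e := by
  obtain ⟨v, k, rfl⟩ : ∃ v k, e = edgeOf v k := ⟨(e.1, false), e.2, rfl⟩
  obtain ⟨w, k', rfl⟩ : ∃ w k', f = edgeOf w k' := ⟨(f.1, false), f.2, rfl⟩
  have meet : ∀ v' w' : Vertex L, edgeOf v k = edgeOf v' k → edgeOf w k' = edgeOf w' k' → v' = w' →
      edgeExp (edgeOf v k) (i + single (edgeOf w k')) + edgeExp (edgeOf w k') i =
      edgeExp (edgeOf w k') (i + single (edgeOf v k)) + edgeExp (edgeOf v k) i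
        - linking (indicator (edgeOf w k')) (edgeOf v k) := by
    rintro v' _ hv hw rfl
    rw [hv, hw]
    by_cases hk : k = k'
    · subst hk
      have h2 := step_ne v' k
      have h3 : around (indicator (edgeOf v' k)) (step v' k) k = 0 := by
        rw [← edgeOf_step, around_indicator_self, turn_self]
      rw [linking_edgeOf, around_indicator_self, turn_self, h3]
      ring
    · exact hL.edgeExp_comm_of_ne v' hk i
  have hv := (edgeOf_step v k).symm
  have hw := (edgeOf_step w k').symm
  by_cases h1 : v = w
  · exact meet _ _ rfl rfl h1
  by_cases h2 : v = step w k'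
  · exact meet _ _ rfl hw h2
  by_cases h3 : step v k = w
  · exact meet _ _ hv rfl h3
  by_cases h4 : step v k = step w k'
  · exact meet _ _ hv hw h4
  have h5 : step w k' ≠ v := fun h => h2 h.symm
  have h6 : w ≠ step v k := fun h => h3 h.symm
  have h7 : step w k' ≠ step v k := fun h => h4 h.symm
  rw [linking_edgeOf, around_indicator_of_ne h1 h2, around_indicator_of_ne h3 h4]
  simp only [edgeExp_edgeOf, loc_add, loc_single, h1, h2, h3, h4, h5, h6, h7, Ne.symm h1, or_self,
    if_false, add_zero]
  ring

/-! ### Products of short strings -/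

/-- The configuration occupied on the edges that occur an odd number of times in the list. -/
noncomputable def listConfig (es : List (Edge L)) : Config L := (es.map single).sum

/-- The exponent of the phase of the product of short string operators along a list of edges, the
first edge acting first. -/
noncomputable def listExp : List (Edge L) → Config L → ZMod 4
  | [], _ => 0
  | e :: es, i => edgeExp e i + listExp es (i + single e)

/-- The multiplicity function of a list of edges. -/
noncomputable def multiplicity (es : List (Edge L)) : Edge L → ZMod 4 := (es.map indicator).sum

/-- The total orientation of the edges in the first list relative to those in the second list. -/
noncomputable def listLinking (es fs : List (Edge L)) : ZMod 4 :=
  (es.map (linking (multiplicity fs))).sum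

@[simp] theorem listConfig_nil : listConfig ([] : List (Edge L)) = 0 := rfl

@[simp] theorem listConfig_cons (e : Edge L) (es : List (Edge L)) :
    listConfig (e :: es) = single e + listConfig es := by simp [listConfig]

theorem listConfig_append (es fs : List (Edge L)) :
    listConfig (es ++ fs) = listConfig es + listConfig fs := by simp [listConfig]

theorem listExp_append (es fs : List (Edge L)) (i : Config L) :
    listExp (es ++ fs) i = listExp es i + listExp fs (i + listConfig es) := by
  induction es generalizing i with
  | nil => simp [listExp]
  | cons e es ih => simp only [List.cons_append, listExp, ih, listConfig_cons]; rw [add_assoc, add_assoc]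

theorem Generic.listExp_add_plaqConfig (hL : Generic L) (es : List (Edge L)) (p : Plaquette L)
    (i : Config L) :
    listExp es (i + plaqConfig p) - listExp es i
      = plaqExp p (i + listConfig es) - plaqExp p i := by
  induction es generalizing i with
  | nil => simp [listExp]
  | cons e es ih =>
    have h := ih (i + single e)
    have h' := hL.edgeExp_add_plaqConfig e p i
    rw [listExp, listExp, listConfig_cons, add_right_comm, ← add_assoc i]
    linear_combination h + h'

theorem Generic.listExp_add_single (hL : Generic L) (es : List (Edge L)) (f : Edge L)
    (i : Config L) :
    listExp es (i + single f) + edgeExp f i =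
      edgeExp f (i + listConfig es) + listExp es i
        - (es.map (linking (indicator f))).sum := by
  induction es generalizing i with
  | nil => simp [listExp]
  | cons e es ih =>
    have h := ih (i + single e)
    have h' := hL.edgeExp_comm e f i
    rw [listExp, listExp, listConfig_cons, add_right_comm i (single f), ← add_assoc i,
      List.map_cons, List.sum_cons]
    linear_combination h + h'

theorem listLinking_cons_right (es fs : List (Edge L)) (f : Edge L) :
    listLinking es (f :: fs) = (es.map (linking (indicator f))).sum + listLinking es fs := by
  have h : multiplicity (f :: fs) = indicator f + multiplicity fs := by simp [multiplicity]
  rw [listLinking, listLinking, ← List.sum_map_add, h]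
  congr 2
  funext e
  exact linking_add _ _ e

/-- Exchanging two products of short string operators costs a power of the imaginary unit. -/
theorem Generic.listExp_comm (hL : Generic L) (es fs : List (Edge L)) (i : Config L) :
    listExp es (i + listConfig fs) + listExp fs i =
      listExp fs (i + listConfig es) + listExp es i - listLinking es fs := by
  induction fs generalizing i with
  | nil =>
    have : listLinking es ([] : List (Edge L)) = 0 := by
      have h0 : linking (multiplicity ([] : List (Edge L))) = fun _ => 0 := funext linking_zero
      rw [listLinking, h0]
      simp
    simp [listExp, this]
  | cons f fs ih =>
    have h := ih (i + single f)
    have h' := hL.listExp_add_single es f i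
    rw [listExp, listExp, listConfig_cons, listLinking_cons_right, add_right_comm i, ← add_assoc i]
    linear_combination h + h'

theorem Generic.listLinking_antisymm (hL : Generic L) (es fs : List (Edge L)) :
    listLinking fs es = -listLinking es fs := by
  linear_combination hL.listExp_comm es fs 0 + hL.listExp_comm fs es 0

/-! ### Operators that permute string configurations up to phases -/

/-- The operator `|i⟩ ↦ F(i) |i ⊕ α⟩`. -/
noncomputable def monomialOp (α : Config L) (F : Config L → ℂ) : Operator L := flip α * diagonal F

theorem config_add_self (α : Config L) : α + α = 0 := by
  funext e
  exact (by decide : ∀ a : ZMod 2, a + a = 0) (α e)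

theorem config_add_add_cancel (i α : Config L) : i + α + α = i := by
  rw [add_assoc, config_add_self, add_zero]

theorem monomialOp_apply (α : Config L) (F : Config L → ℂ) (ψ : State L) (i : Config L) :
    monomialOp α F ψ i = F (i + α) * ψ (i + α) := rfl

theorem monomialOp_mul (α β : Config L) (F G : Config L → ℂ) :
    monomialOp α F * monomialOp β G = monomialOp (α + β) fun i => F (i + β) * G i := by
  ext1 ψ
  funext i
  rw [Module.End.mul_apply, monomialOp_apply, monomialOp_apply, monomialOp_apply, ← add_assoc,
    config_add_add_cancel, mul_assoc]

theorem diagonal_eq (F : Config L → ℂ) : diagonal F = monomialOp 0 F := by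
  ext1 ψ
  funext i
  rw [monomialOp_apply, add_zero]
  rfl

theorem one_eq_monomialOp : (1 : Operator L) = monomialOp 0 fun _ => 1 := by
  ext1 ψ
  funext i
  rw [monomialOp_apply, add_zero, one_mul]
  rfl

theorem smul_monomialOp (c : ℂ) (α : Config L) (F : Config L → ℂ) :
    c • monomialOp α F = monomialOp α fun i => c * F i := by
  ext1 ψ
  funext i
  rw [LinearMap.smul_apply, Pi.smul_apply, monomialOp_apply, monomialOp_apply, smul_eq_mul,
    mul_assoc]

/-! ### Paths and their edges -/

/-- The edges of the walk that starts at `v` and follows the given labels. -/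
def edgeList (v : Vertex L) : List (ZMod 3) → List (Edge L)
  | [] => []
  | k :: ks => edgeOf v k :: edgeList (step v k) ks

theorem edgeList_append (v : Vertex L) (ks ks' : List (ZMod 3)) :
    edgeList v (ks ++ ks') = edgeList v ks ++ edgeList (ks.foldl step v) ks' := by
  induction ks generalizing v with
  | nil => rfl
  | cons k ks ih => simp [edgeList, ih]

theorem edgeList_getElem? (v : Vertex L) (ks : List (ZMod 3)) (i : ℕ) :
    (edgeList v ks)[i]? = ks[i]?.map (edgeOf ((ks.take i).foldl step v)) := by
  induction ks generalizing v i with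
  | nil => rfl
  | cons k ks ih =>
    cases i with
    | zero => rfl
    | succ i => simpa [edgeList] using ih (step v k) i

theorem edgeList_length (v : Vertex L) (ks : List (ZMod 3)) :
    (edgeList v ks).length = ks.length := by
  induction ks generalizing v with
  | nil => rfl
  | cons k ks ih => simp [edgeList, ih]

/-- The charge of a configuration at a vertex: the number of occupied edges at this vertex,
modulo `2`. -/
def charge (β : Config L) (v : Vertex L) : ZMod 2 := ∑ k, loc β v k

theorem charge_add (β γ : Config L) (v : Vertex L) :
    charge (β + γ) v = charge β v + charge γ v := by
  simp [charge, loc_add, Finset.sum_add_distrib]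

theorem charge_zero (v : Vertex L) : charge (0 : Config L) v = 0 := by simp [charge, loc]

open Classical in
theorem charge_single (u v : Vertex L) (k : ZMod 3) :
    charge (single (edgeOf v k)) u = (if u = v then 1 else 0) + if u = step v k then 1 else 0 := by
  rw [charge, loc_single]
  have h := step_ne v k
  by_cases h1 : u = v
  · subst h1; simp [h.symm]
  · by_cases h2 : u = step v k <;> simp [h1, h2, h]

open Classical in
/-- The charges of a walk sit at its end points. -/
theorem charge_edgeList (u v : Vertex L) (ks : List (ZMod 3)) :
    charge (listConfig (edgeList v ks)) u =
      (if u = v then 1 else 0) + if u = ks.foldl step v then 1 else 0 := by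
  induction ks generalizing v with
  | nil =>
    rw [edgeList, listConfig_nil, charge_zero]
    exact ((by decide : ∀ a : ZMod 2, a + a = 0) _).symm
  | cons k ks ih =>
    rw [edgeList, listConfig_cons, charge_add, charge_single, ih, List.foldl_cons]
    linear_combination (by decide : ∀ a : ZMod 2, a + a = 0) (if u = step v k then 1 else 0)

theorem Generic.charge_plaqConfig (hL : Generic L) (p : Plaquette L) (v : Vertex L) :
    charge (plaqConfig p) v = 0 := by
  by_cases h : ∃ m, plaq v m = p
  · obtain ⟨m, rfl⟩ := h
    rw [charge, hL.loc_plaqConfig]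
    exact (by decide : ∀ m, ∑ k, pair m k = 0) m
  · push Not at h
    rw [charge, loc_plaqConfig_of_ne h]
    simp

open Classical in
theorem listConfig_apply_of_nodup {es : List (Edge L)} (h : es.Nodup) (e : Edge L) :
    listConfig es e = if e ∈ es then 1 else 0 := by
  induction es with
  | nil => rfl
  | cons f es ih =>
    obtain ⟨hf, h⟩ := List.nodup_cons.mp h
    have : single f e = if e = f then 1 else 0 := by rw [single, Pi.single_apply]
    rw [listConfig_cons, Pi.add_apply, ih h, this]
    by_cases hef : e = f
    · subst hef; simp [hf]
    · simp [hef]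

namespace Path

/-- The edges of a path, in order. -/
def edges (P : Path L) : List (Edge L) := edgeList P.start P.labels

theorem edges_getElem? (P : Path L) (i : ℕ) : P.edges[i]? = P.edge? i :=
  edgeList_getElem? _ _ _

theorem edges_length (P : Path L) : P.edges.length = P.len := edgeList_length _ _

theorem mem_edges (P : Path L) (e : Edge L) : e ∈ P.edges ↔ e ∈ P.edgeSet := by
  simp [List.mem_iff_getElem?, edges_getElem?, edgeSet]

theorem vert_zero (P : Path L) : P.vert 0 = P.start := by simp [vert]

theorem vert_succ (P : Path L) {i : ℕ} {k : ZMod 3} (h : P.labels[i]? = some k) :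
    P.vert (i + 1) = step (P.vert i) k := by
  rw [vert, vert, List.take_add_one, h]
  simp

theorem finish_eq (P : Path L) : P.finish = P.labels.foldl step P.start := by
  simp [finish, vert, len]

theorem exists_label (P : Path L) {i : ℕ} (h : i < P.len) : ∃ k, P.labels[i]? = some k :=
  ⟨_, List.getElem?_eq_getElem h⟩

theorem lt_len (P : Path L) {i : ℕ} {k : ZMod 3} (h : P.labels[i]? = some k) : i < P.len := by
  rw [List.getElem?_eq_some_iff] at h
  exact h.1

theorem vert_mem (P : Path L) {i : ℕ} (h : i ≤ P.len) : P.vert i ∈ P.vertexSet := ⟨i, h, rfl⟩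

/-- Every edge of a path joins two consecutive vertices. -/
theorem exists_of_mem_edges {P : Path L} {e : Edge L} (h : e ∈ P.edges) :
    ∃ i k, P.labels[i]? = some k ∧ e = edgeOf (P.vert i) k := by
  obtain ⟨i, hi⟩ := (P.mem_edges e).mp h
  rw [edge?, Option.map_eq_some_iff] at hi
  obtain ⟨k, hk, rfl⟩ := hi
  exact ⟨i, k, hk, rfl⟩

theorem mem_vertexSet_of_mem_edges {P : Path L} {v : Vertex L} {k : ZMod 3}
    (h : edgeOf v k ∈ P.edges) : v ∈ P.vertexSet := by
  obtain ⟨i, k', hk, he⟩ := exists_of_mem_edges h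
  have hi := P.lt_len hk
  obtain ⟨-, rfl | rfl⟩ := (edgeOf_eq_iff _ _ _ _).mp he
  · exact P.vert_mem hi.le
  · rw [← P.vert_succ hk]; exact P.vert_mem hi

theorem vert_injOn {P : Path L} (ho : P.IsOpen) (hc : ¬ P.SelfCrossing) {i j : ℕ}
    (hi : i ≤ P.len) (hj : j ≤ P.len) (h : P.vert i = P.vert j) : i = j := by
  by_contra hij
  have key : ∀ i j, i ≤ P.len → j ≤ P.len → P.vert i = P.vert j → i ≠ j → i = 0 ∨ i = P.len := by
    intro i j hi hj h hij
    by_contra hcon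
    push Not at hcon
    exact hc ⟨i, j, Nat.pos_of_ne_zero hcon.1, lt_of_le_of_ne hi hcon.2, hj, hij.symm, h⟩
  rcases key i j hi hj h hij with rfl | rfl <;>
    rcases key j _ hj hi h.symm (Ne.symm hij) with rfl | rfl
  · exact hij rfl
  · exact ho (by rw [IsClosed, ← vert_zero, h]; rfl)
  · exact ho (by rw [IsClosed, ← vert_zero, ← h]; rfl)
  · exact hij rfl

theorem nodup_edges {P : Path L} (ho : P.IsOpen) (hc : ¬ P.SelfCrossing) : P.edges.Nodup := by
  rw [List.nodup_iff_getElem?_ne_getElem?]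
  intro i j hij hj
  rw [edges_length] at hj
  obtain ⟨k, hk⟩ := P.exists_label (hij.trans hj)
  obtain ⟨k', hk'⟩ := P.exists_label hj
  rw [edges_getElem?, edges_getElem?, edge?, edge?, hk, hk']
  simp only [Option.map_some, ne_eq, Option.some.injEq]
  intro h
  obtain ⟨rfl, h | h⟩ := (edgeOf_eq_iff _ _ _ _).mp h
  · exact absurd (vert_injOn ho hc (by omega) (by omega) h) (by omega)
  · rw [← P.vert_succ hk'] at h
    exact absurd (vert_injOn ho hc (by omega) (by omega) h) (by omega)

theorem config_eq {P : Path L} (ho : P.IsOpen) (hc : ¬ P.SelfCrossing) :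
    P.config = listConfig P.edges := by
  classical
  funext e
  have : P.config e = if e ∈ P.edgeSet then 1 else 0 := by
    unfold config occupied; congr
  rw [listConfig_apply_of_nodup (nodup_edges ho hc), this]
  simp only [mem_edges]

theorem charge_listConfig_edges {P Q : Path L} (h : P.Cross Q) {v : Vertex L}
    (hv : v ∈ P.vertexSet) : charge (listConfig Q.edges) v = 0 := by
  classical
  rw [edges, charge_edgeList, ← finish_eq]
  by_cases hQ : Q.IsClosed
  · rw [← show Q.start = Q.finish from hQ]
    exact (by decide : ∀ a : ZMod 2, a + a = 0) _
  · obtain ⟨h1, h2⟩ := h.2 hQ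
    have h3 : v ≠ Q.start := fun h' => h1 (h' ▸ hv)
    have h4 : v ≠ Q.finish := fun h' => h2 (h' ▸ hv)
    rw [if_neg h3, if_neg h4, add_zero]

/-! ### Concatenations -/

theorem mem_vertexSet_iff (P : Path L) (v : Vertex L) :
    v ∈ P.vertexSet ↔ ∃ ks, ks <+: P.labels ∧ ks.foldl step P.start = v := by
  constructor
  · rintro ⟨i, -, rfl⟩
    exact ⟨_, List.take_prefix _ _, rfl⟩
  · rintro ⟨ks, h, rfl⟩
    refine ⟨ks.length, h.length_le, ?_⟩
    rw [vert, ← List.prefix_iff_eq_take.mp h]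

theorem edgeList_flatMap (Ps : List (Path L)) (s : Vertex L)
    (hc : Ps.IsChain fun R R' => R.finish = R'.start) (hs : ∀ R ∈ Ps.head?, R.start = s) :
    edgeList s (Ps.flatMap labels) = Ps.flatMap edges := by
  induction Ps generalizing s with
  | nil => rfl
  | cons R Ps ih =>
    have h0 : R.start = s := hs R rfl
    rw [List.flatMap_cons, List.flatMap_cons, edgeList_append, ← h0, ← finish_eq]
    rw [List.isChain_cons] at hc
    rw [ih _ hc.2 fun R' hR' => (hc.1 R' hR').symm]
    rfl

theorem vertexSet_subset_flatMap (Ps : List (Path L)) (s : Vertex L)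
    (hc : Ps.IsChain fun R R' => R.finish = R'.start) (hs : ∀ R ∈ Ps.head?, R.start = s)
    (R : Path L) (hR : R ∈ Ps) : R.vertexSet ⊆ (⟨s, Ps.flatMap labels⟩ : Path L).vertexSet := by
  induction Ps generalizing s with
  | nil => cases hR
  | cons R' Ps ih =>
    have h0 : R'.start = s := hs R' rfl
    rw [List.isChain_cons] at hc
    intro v hv
    rw [mem_vertexSet_iff]
    rcases List.mem_cons.mp hR with rfl | hR
    · obtain ⟨ks, h, rfl⟩ := (mem_vertexSet_iff _ _).mp hv
      exact ⟨ks, h.trans (List.prefix_append _ _), by rw [h0]⟩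
    · have h1 := ih _ hc.2 (fun R'' h => (hc.1 R'' h).symm) hR hv
      obtain ⟨ks, h, rfl⟩ := (mem_vertexSet_iff _ _).mp h1
      refine ⟨R'.labels ++ ks, ?_, ?_⟩
      · exact (List.prefix_append_right_inj _).mpr h
      · rw [List.foldl_append]
        change ks.foldl step (R'.labels.foldl step s) = ks.foldl step R'.finish
        rw [finish_eq, h0]

theorem IsConcatenation.head {P : Path L} {Ps : List (Path L)} (h : P.IsConcatenation Ps) :
    ∀ R ∈ Ps.head?, R.start = P.start := by
  intro R hR
  have := h.2.2.1
  rw [Option.mem_def.mp hR] at this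
  simpa using this

theorem IsConcatenation.edges_eq {P : Path L} {Ps : List (Path L)} (h : P.IsConcatenation Ps) :
    P.edges = Ps.flatMap edges := by
  rw [edges, h.2.2.2]
  exact edgeList_flatMap _ _ h.2.1 h.head

theorem IsConcatenation.vertexSet_subset {P : Path L} {Ps : List (Path L)}
    (h : P.IsConcatenation Ps) {R : Path L} (hR : R ∈ Ps) : R.vertexSet ⊆ P.vertexSet := by
  have := vertexSet_subset_flatMap Ps P.start h.2.1 h.head R hR
  rwa [← h.2.2.2] at this

theorem IsConcatenation.len_pos {P : Path L} {Ps : List (Path L)} (h : P.IsConcatenation Ps) :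
    0 < P.len := by
  cases Ps with
  | nil => exact absurd h.2.2.1 (by simp)
  | cons R Ps =>
    rw [len, h.2.2.2, List.flatMap_cons, List.length_append]
    have : R.labels ≠ [] := fun h0 => (h.1 R List.mem_cons_self).1 (by
      rw [IsClosed, finish_eq, h0]; rfl)
    have := List.length_pos_of_ne_nil this
    omega

end Path

/-! ### Phases given by the algorithm -/

/-- The total configuration of a list of plaquettes. -/
noncomputable def plaqListConfig (ps : List (Plaquette L)) : Config L := (ps.map plaqConfig).sum

theorem plaqListConfig_nil : plaqListConfig ([] : List (Plaquette L)) = 0 := rfl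

theorem plaqListConfig_cons (p : Plaquette L) (ps : List (Plaquette L)) :
    plaqListConfig (p :: ps) = plaqConfig p + plaqListConfig ps := by simp [plaqListConfig]

theorem plaqListConfig_concat (ps : List (Plaquette L)) (p : Plaquette L) :
    plaqListConfig (ps ++ [p]) = plaqListConfig ps + plaqConfig p := by simp [plaqListConfig]

namespace Path

theorem loc_eq_of_eqOn {P : Path L} {i j : Config L} (h : Set.EqOn i j P.conn) {v : Vertex L}
    (hv : v ∈ P.vertexSet) : loc i v = loc j v :=
  funext fun k => h ⟨v, hv, k, rfl⟩

theorem loc_config_of_not_mem {P : Path L} {v : Vertex L} (hv : v ∉ P.vertexSet) :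
    loc P.config v = 0 := by
  funext k
  have : edgeOf v k ∉ P.edgeSet := fun h => hv (mem_vertexSet_of_mem_edges ((P.mem_edges _).mpr h))
  exact if_neg this

/-- How the exponent of the phase of the plaquette `p` changes along a path depends on the
configuration near the path only. -/
theorem plaqExp_sub_congr {P : Path L} {i j : Config L} (h : Set.EqOn i j P.conn)
    (p : Plaquette L) :
    plaqExp p (i + P.config) - plaqExp p i = plaqExp p (j + P.config) - plaqExp p j := by
  simp only [plaqExp, ← Finset.sum_sub_distrib]
  refine Finset.sum_congr rfl fun s _ => Finset.sum_congr rfl fun m _ => ?_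
  by_cases hv : cornerAt p s m ∈ P.vertexSet
  · rw [loc_add, loc_add, loc_eq_of_eqOn h hv]
  · rw [loc_add, loc_add, loc_config_of_not_mem hv]
    simp

theorem mem_plaquettes_of_mem_vertexSet {P : Path L} {v : Vertex L} (hv : v ∈ P.vertexSet)
    {m : ZMod 3} {p : Plaquette L} (h : plaq v m = p) : p ∈ P.plaquettes :=
  ⟨edgeOf v (m + 1), (edgeOf_mem_boundary_iff _ _ _).mpr ⟨m, by simp, h⟩, v, hv, m + 1, rfl⟩

theorem plaqConfig_eqOn_zero {P : Path L} {p : Plaquette L} (h : p ∉ P.plaquettes) :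
    Set.EqOn (plaqConfig p) 0 P.conn := fun _ he => if_neg fun hb => h ⟨_, hb, he⟩

theorem plaqExp_of_not_mem {P : Path L} {p : Plaquette L} (h : p ∉ P.plaquettes) (i : Config L) :
    plaqExp p (i + P.config) = plaqExp p i := by
  simp only [plaqExp]
  refine Finset.sum_congr rfl fun s _ => Finset.sum_congr rfl fun m _ => ?_
  rw [loc_add, loc_config_of_not_mem, add_zero]
  exact fun hv => h (mem_plaquettes_of_mem_vertexSet hv ((cornerAt_eq_iff p s m _).mp rfl).2)

theorem theta_concat (P : Path L) (i : Config L) (ps : List (Plaquette L)) (p : Plaquette L) :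
    P.theta i (ps ++ [p]) =
      phase (plaqExp p (i + plaqListConfig ps + P.config) - plaqExp p (i + plaqListConfig ps)) *
        P.theta i ps := by
  induction ps generalizing i with
  | nil =>
    simp [plaqListConfig_nil, theta, plaquettePhase_eq, sub_eq_add_neg, phase_add, phase_neg, div_eq_mul_inv]
  | cons q ps ih =>
    rw [List.cons_append, theta, theta, ih, plaqListConfig_cons, ← add_assoc]
    ring

/-- A string operator commutes with all plaquette operators. -/
theorem IsAlgorithmOutput.add_plaqConfig (hL : Generic L) {P : Path L} (ho : P.IsOpen)
    (hc : ¬ P.SelfCrossing) {F : Config L → ℂ} (hF : P.IsAlgorithmOutput F) (i : Config L)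
    (p : Plaquette L) :
    F (i + plaqConfig p) = phase (plaqExp p (i + P.config) - plaqExp p i) * F i := by
  classical
  obtain ⟨hconn, rep, hclass, -, -, htheta⟩ := hF
  by_cases hp : p ∈ P.plaquettes
  · obtain ⟨T, hT, hi⟩ := hclass i
    have sum_eq : ∀ S : Finset (Plaquette L),
        plaqListConfig S.toList = ∑ q ∈ S, plaqConfig q := fun S => Finset.sum_map_toList _ _
    have hiT : Set.EqOn i (rep i + ∑ q ∈ T, plaqConfig q) P.conn := fun e he => by
      rw [Pi.add_apply, hi e he]
      linear_combination
        -(by decide : ∀ a : ZMod 2, a + a = 0) ((∑ q ∈ T, plaqConfig q) e)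
    -- one more plaquette, added to a representative that has been moved by the plaquettes `S`
    have step_one : ∀ S : Finset (Plaquette L), (S : Set (Plaquette L)) ⊆ P.plaquettes → p ∉ S →
        F (rep i + (∑ q ∈ S, plaqConfig q) + plaqConfig p) =
        phase (plaqExp p (rep i + (∑ q ∈ S, plaqConfig q) + P.config)
          - plaqExp p (rep i + ∑ q ∈ S, plaqConfig q)) * F (rep i + ∑ q ∈ S, plaqConfig q) := by
      intro S hS hpS
      have h1 := htheta i S.toList S.nodup_toList fun q hq => hS (Finset.mem_toList.mp hq)
      have h2 := htheta i (S.toList ++ [p])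
        (by
          rw [List.nodup_append]
          refine ⟨S.nodup_toList, List.nodup_singleton p, ?_⟩
          intro a ha b hb
          rw [List.mem_singleton] at hb
          rintro rfl
          exact hpS (hb ▸ Finset.mem_toList.mp ha))
        (by
          intro q hq
          rcases List.mem_append.mp hq with hq | hq
          · exact hS (Finset.mem_toList.mp hq)
          · rwa [List.mem_singleton.mp hq])
      change F (rep i + plaqListConfig _) = _ at h1 h2
      rw [theta_concat, mul_assoc, ← h1, plaqListConfig_concat, ← add_assoc, sum_eq] at h2
      exact h2
    by_cases hpT : p ∈ T
    · have hT' : ((T.erase p : Finset (Plaquette L)) : Set (Plaquette L)) ⊆ P.plaquettes :=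
        fun q hq => hT (Finset.mem_of_mem_erase hq)
      have h := step_one (T.erase p) hT' (Finset.notMem_erase p T)
      set j := rep i + ∑ q ∈ T.erase p, plaqConfig q with hj
      have hij : Set.EqOn i (j + plaqConfig p) P.conn := by
        rw [hj, add_assoc, Finset.sum_erase_add _ _ hpT]; exact hiT
      have hij' : Set.EqOn (i + plaqConfig p) j P.conn := fun e he => by
        rw [Pi.add_apply, hij he, ← Pi.add_apply, config_add_add_cancel]
      rw [hconn _ _ hij', hconn _ _ hij, plaqExp_sub_congr hij, h, ← mul_assoc, ← phase_add]
      -- the plaquette operator squares to one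
      have hsq : plaqExp p (j + plaqConfig p + P.config) - plaqExp p (j + plaqConfig p) +
          (plaqExp p (j + P.config) - plaqExp p j) = 0 := by
        rw [config_eq ho hc, ← hL.listExp_add_plaqConfig, ← hL.listExp_add_plaqConfig,
          config_add_add_cancel]
        ring
      rw [hsq, phase_zero, one_mul]
    · have h := step_one T hT hpT
      have hiT' : Set.EqOn (i + plaqConfig p) (rep i + (∑ q ∈ T, plaqConfig q) + plaqConfig p)
          P.conn := fun e he => by rw [Pi.add_apply, hiT he]; rfl
      rw [hconn _ _ hiT', hconn _ _ hiT, plaqExp_sub_congr hiT, h]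
  · have h0 : Set.EqOn (i + plaqConfig p) i P.conn := fun e he => by
      rw [Pi.add_apply, plaqConfig_eqOn_zero hp he]; simp
    rw [hconn _ _ h0, plaqExp_of_not_mem hp, sub_self, phase_zero, one_mul]

theorem edgeExp_congr {P : Path L} {i j : Config L} (h : Set.EqOn i j P.conn) {e : Edge L}
    (he : e ∈ P.edges) : edgeExp e i = edgeExp e j := by
  obtain ⟨a, k, hk, rfl⟩ := exists_of_mem_edges he
  have ha := P.lt_len hk
  rw [edgeExp_edgeOf, edgeExp_edgeOf, ← P.vert_succ hk, loc_eq_of_eqOn h (P.vert_mem ha.le),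
    loc_eq_of_eqOn h (P.vert_mem ha)]

theorem listExp_congr {P : Path L} {i j : Config L} (h : Set.EqOn i j P.conn)
    {es : List (Edge L)} (hes : ∀ e ∈ es, e ∈ P.edges) : listExp es i = listExp es j := by
  induction es generalizing i j with
  | nil => rfl
  | cons e es ih =>
    rw [listExp, listExp, edgeExp_congr h (hes e List.mem_cons_self),
      ih (j := j + single e) (fun e' he' => by rw [Pi.add_apply, h he', Pi.add_apply])
        fun f hf => hes f (List.mem_cons_of_mem _ hf)]

/-- Near a path that does not overlap itself, a configuration without charges on the path is the
boundary of a set of plaquettes. -/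
theorem exists_plaquettes (hL : Generic L) {P : Path L} (hP : ¬ P.SelfOverlapping) {β : Config L}
    (hβ : ∀ v ∈ P.vertexSet, charge β v = 0) :
    ∃ ps : List (Plaquette L), Set.EqOn β (plaqListConfig ps) P.conn := by
  have hcharge : ∀ (ps : List (Plaquette L)) (v : Vertex L), charge (plaqListConfig ps) v = 0 := by
    intro ps v
    induction ps with
    | nil => exact charge_zero v
    | cons p ps ih =>
      rw [plaqListConfig_cons, charge_add, hL.charge_plaqConfig,
        zero_add]
      exact ih
  have self_add : ∀ x : ZMod 3 → ZMod 2, x + x = 0 := by decide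
  suffices h : ∀ t ≤ P.len, ∃ ps : List (Plaquette L), ∀ s ≤ t,
      loc β (P.vert s) = loc (plaqListConfig ps) (P.vert s) by
    obtain ⟨ps, hps⟩ := h P.len le_rfl
    refine ⟨ps, ?_⟩
    rintro e ⟨v, ⟨s, hs, rfl⟩, k, rfl⟩
    exact congrFun (hps s hs) k
  -- with three edges at a vertex, zero charge leaves no occupied edge or the boundary of a plaquette
  have tri : ∀ x : ZMod 3 → ZMod 2, ∑ k, x k = 0 → x = 0 ∨ ∃ m, x = pair m := by decide
  intro t
  induction t with
  | zero =>
    intro _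
    rcases tri _ (hβ _ (P.vert_mem (Nat.zero_le _))) with h | ⟨m, h⟩
    · refine ⟨[], fun s hs => ?_⟩
      rw [Nat.le_zero.mp hs, h]; rfl
    · refine ⟨[plaq (P.vert 0) m], fun s hs => ?_⟩
      rw [Nat.le_zero.mp hs, h, ← hL.loc_plaqConfig, plaqListConfig_cons, plaqListConfig_nil,
        add_zero]
  | succ t ih =>
    intro ht
    obtain ⟨ps, hps⟩ := ih (by omega)
    obtain ⟨k, hk⟩ := P.exists_label (i := t) (by omega)
    have hv := P.vert_succ hk
    have hγ : charge (β + plaqListConfig ps) (P.vert (t + 1)) = 0 := by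
      rw [charge_add, hcharge, hβ _ (P.vert_mem ht), add_zero]
    have hγk : loc (β + plaqListConfig ps) (P.vert (t + 1)) k = 0 := by
      have h1 : loc (β + plaqListConfig ps) (P.vert t) k = 0 := by
        rw [loc_add, hps t le_rfl, self_add]; rfl
      rw [hv, loc, edgeOf_step]
      exact h1
    rcases tri _ hγ with h | ⟨m, h⟩
    · refine ⟨ps, fun s hs => ?_⟩
      rcases Nat.le_succ_iff.mp hs with hs | rfl
      · exact hps s hs
      · rw [loc_add] at h
        rw [← add_zero (loc β _), ← self_add (loc (plaqListConfig ps) _), ← add_assoc, h, zero_add]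
    · have hmk : m = k := by
        rw [h, pair] at hγk
        by_contra hne
        rw [if_neg (fun h => hne h.symm)] at hγk
        exact absurd hγk (by decide)
      subst hmk
      refine ⟨plaq (P.vert (t + 1)) m :: ps, fun s hs => ?_⟩
      rw [plaqListConfig_cons, loc_add]
      rcases Nat.le_succ_iff.mp hs with hs | rfl
      · -- the new plaquette misses the earlier vertices, as the path does not overlap itself
        have hne : ∀ m', plaq (P.vert s) m' ≠ plaq (P.vert (t + 1)) m := by
          intro m' h'
          rcases hs.lt_or_eq with hs | rfl
          · refine hP ⟨plaq (P.vert (t + 1)) m, s, t, t + 1, hs, by omega, ht, ?_, ?_, ?_⟩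
            · exact (mem_corners_iff _ _).mpr ⟨m', h'⟩
            · rw [mem_corners_iff]
              rintro ⟨m'', h''⟩
              rw [hv] at h''
              exact hL.plaq_step_ne _ _ _ h''.symm
            · exact (mem_corners_iff _ _).mpr ⟨m, rfl⟩
          · rw [hv] at h'
            exact hL.plaq_step_ne _ _ _ h'.symm
        rw [loc_plaqConfig_of_ne hne, zero_add]
        exact hps s hs
      · rw [hL.loc_plaqConfig, ← h, loc_add, add_assoc]
        change _ = _ + (loc (plaqListConfig ps) _ + loc (plaqListConfig ps) _)
        rw [self_add, add_zero]

/-- The operator `S` is the product of the short string operators along the edges `es`, up to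
phases `H` that do not change when a configuration without charges on `V` is added. -/
def IsStandard (V : Set (Vertex L)) (es : List (Edge L)) (S : Operator L) : Prop :=
  ∃ H : Config L → ℂ,
    (∀ β : Config L, (∀ v ∈ V, charge β v = 0) → ∀ i, H (i + β) = H i) ∧
    S = monomialOp (listConfig es) fun i => phase (listExp es i) * H i

theorem IsSimpleString.isStandard (hL : Generic L) {P : Path L}
    (hP : P.IsOpen ∧ ¬ P.SelfCrossing ∧ ¬ P.SelfOverlapping) {S : Operator L}
    (hS : P.IsSimpleString S) : IsStandard P.vertexSet P.edges S := by
  obtain ⟨F, hF, rfl⟩ := hS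
  obtain ⟨ho, hc, hov⟩ := hP
  set H : Config L → ℂ := fun i => phase (-listExp P.edges i) * F i with hH
  have hplaq : ∀ i p, H (i + plaqConfig p) = H i := by
    intro i p
    have h := hL.listExp_add_plaqConfig P.edges p i
    simp only [hH]
    rw [hF.add_plaqConfig hL ho hc, config_eq ho hc, ← h, ← mul_assoc, ← phase_add]
    congr 2
    ring
  have hlist : ∀ (ps : List (Plaquette L)) i, H (i + plaqListConfig ps) = H i := by
    intro ps
    induction ps with
    | nil => intro i; simp [plaqListConfig_nil]
    | cons p ps ih =>
      intro i
      rw [plaqListConfig_cons, ← add_assoc]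
      exact (ih _).trans (hplaq i p)
  refine ⟨H, fun β hβ i => ?_, ?_⟩
  · obtain ⟨ps, hps⟩ := exists_plaquettes hL hov hβ
    rw [← hlist ps i]
    have hcongr : Set.EqOn (i + β) (i + plaqListConfig ps) P.conn := fun e he => by
      rw [Pi.add_apply, hps he]; rfl
    simp only [hH]
    rw [hF.1 _ _ hcongr, listExp_congr hcongr fun _ h => h]
  · rw [config_eq ho hc, ← monomialOp]
    congr 1
    funext i
    rw [hH, ← mul_assoc, ← phase_add, add_neg_cancel, phase_zero, one_mul]

theorem IsStandard.mono {V W : Set (Vertex L)} (h : V ⊆ W) {es : List (Edge L)} {S : Operator L}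
    (hS : IsStandard V es S) : IsStandard W es S := by
  obtain ⟨H, h1, h2⟩ := hS
  exact ⟨H, fun β hβ => h1 β fun v hv => hβ v (h hv), h2⟩

theorem IsStandard.one (V : Set (Vertex L)) : IsStandard V ([] : List (Edge L)) 1 := by
  refine ⟨fun _ => 1, fun _ _ _ => rfl, ?_⟩
  rw [one_eq_monomialOp]
  congr 1
  funext i
  simp [listExp]

theorem IsStandard.mul {V : Set (Vertex L)} {es fs : List (Edge L)} {S T : Operator L}
    (hS : IsStandard V es S) (hT : IsStandard V fs T) : IsStandard V (es ++ fs) (T * S) := by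
  obtain ⟨H, h1, rfl⟩ := hS
  obtain ⟨K, k1, rfl⟩ := hT
  refine ⟨fun i => K (i + listConfig es) * H i, fun β hβ i => ?_, ?_⟩
  · change K (i + β + listConfig es) * H (i + β) = _
    rw [h1 β hβ, add_right_comm, k1 β hβ]
  · rw [monomialOp_mul, listConfig_append, add_comm (listConfig fs)]
    congr 1
    funext i
    rw [listExp_append, phase_add]
    ring

/-- A positive string operator is the product of the short string operators along its path, up to
phases that only depend on the charges on the path. -/
theorem IsPositiveString.isStandard (hL : Generic L) {P : Path L} {Ps : List (Path L)}
    (hP : P.IsConcatenation Ps) {S : Operator L} (hS : IsPositiveString Ps S) :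
    IsStandard P.vertexSet P.edges S := by
  obtain ⟨Ss, hSs, rfl⟩ := hS
  rw [hP.edges_eq]
  have hsub := fun R hR => hP.vertexSet_subset (R := R) hR
  have hsimple := hP.1
  clear hP
  induction hSs with
  | nil => exact IsStandard.one _
  | cons h _ ih =>
    rw [List.flatMap_cons, List.reverse_cons, List.prod_append, List.prod_singleton]
    refine IsStandard.mul ?_ ?_
    · exact (h.isStandard hL (hsimple _ List.mem_cons_self)).mono (hsub _ List.mem_cons_self)
    · exact ih (fun R hR => hsub R (List.mem_cons_of_mem _ hR))
        fun R hR => hsimple R (List.mem_cons_of_mem _ hR)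

/-- Exchanging two positive string operators. -/
theorem IsStandard.comm (hL : Generic L) {P Q : Path L} (hPQ : P.Cross Q) {S T : Operator L}
    (hS : IsStandard P.vertexSet P.edges S) (hT : IsStandard Q.vertexSet Q.edges T) :
    S * T = phase (-listLinking P.edges Q.edges) • (T * S) := by
  obtain ⟨H, h1, rfl⟩ := hS
  obtain ⟨K, k1, rfl⟩ := hT
  rw [monomialOp_mul, monomialOp_mul, smul_monomialOp, add_comm (listConfig P.edges)]
  congr 1
  funext i
  rw [h1 _ (fun v hv => charge_listConfig_edges hPQ hv),
    k1 _ (fun v hv => charge_listConfig_edges ⟨hPQ.2, hPQ.1⟩ hv)]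
  have h := congrArg phase (hL.listExp_comm P.edges Q.edges i)
  rw [sub_eq_add_neg, phase_add, phase_add, phase_add] at h
  linear_combination H i * K i * h

end Path

/-! ### Dual paths -/

/-- The exponent of the phase of a product of Pauli operators `σᶻ`. -/
def dualExp (fs : List (Edge L)) (i : Config L) : ZMod 4 := (fs.map fun f => 2 * lift (i f)).sum

theorem two_mul_lift_add : ∀ a b : ZMod 2, 2 * lift (a + b) = 2 * lift a + 2 * lift b := by decide

theorem dualExp_add (fs : List (Edge L)) (i j : Config L) :
    dualExp fs (i + j) = dualExp fs i + dualExp fs j := by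
  simp only [dualExp, Pi.add_apply, two_mul_lift_add, List.sum_map_add]

theorem prod_sigmaZ (fs : List (Edge L)) :
    (fs.map sigmaZ).prod = monomialOp 0 fun i => phase (dualExp fs i) := by
  induction fs with
  | nil => simp [dualExp, one_eq_monomialOp]
  | cons f fs ih =>
    rw [List.map_cons, List.prod_cons, ih, sigmaZ, diagonal_eq, monomialOp_mul, add_zero]
    congr 1
    funext i
    have h : dualExp (f :: fs) i = 2 * lift (i f) + dualExp fs i := by simp [dualExp]
    rw [add_zero, h, phase_add, lift, phase_two_mul_natCast]

theorem two_mul_lift_listConfig (es : List (Edge L)) (e : Edge L) :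
    2 * lift (listConfig es e) = 2 * multiplicity es e := by
  classical
  induction es with
  | nil => rfl
  | cons f es ih =>
    have h1 : single f e = if e = f then 1 else 0 := by rw [single, Pi.single_apply]
    have h2 : multiplicity (f :: es) = indicator f + multiplicity es := by simp [multiplicity]
    rw [listConfig_cons, Pi.add_apply, two_mul_lift_add, ih, h1, h2, Pi.add_apply, indicator_apply,
      mul_add]
    split_ifs <;> rfl

theorem multiplicity_of_not_mem {es : List (Edge L)} {e : Edge L} (h : e ∉ es) :
    multiplicity es e = 0 := by
  classical
  induction es with
  | nil => rfl
  | cons f es ih =>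
    rw [List.mem_cons, not_or] at h
    have h2 : multiplicity (f :: es) = indicator f + multiplicity es := by simp [multiplicity]
    rw [h2, Pi.add_apply, ih h.2, indicator_apply, if_neg h.1, add_zero]

/-- The number of edges at a vertex, with multiplicities `N`. -/
def degree (N : Edge L → ZMod 4) (v : Vertex L) : ZMod 4 := ∑ k, N (edgeOf v k)

theorem degree_eq (N : Edge L → ZMod 4) (v : Vertex L) (k : ZMod 3) :
    degree N v = N (edgeOf v k) + N (edgeOf v (k + 1)) + N (edgeOf v (k - 1)) := by
  have h3 : ∀ f : ZMod 3 → ZMod 4, ∑ m, f m = f 0 + f 1 + f 2 := fun f => Fin.sum_univ_three f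
  have h11 : (1 + 1 : ZMod 3) = 2 := rfl
  have h21 : (2 + 1 : ZMod 3) = 0 := rfl
  have h22 : (2 - 1 : ZMod 3) = 1 := rfl
  have h01 : (-1 : ZMod 3) = 2 := rfl
  rw [degree, h3]
  rcases label_cases k with rfl | rfl | rfl <;> simp only [h11, h21, h22, h01, zero_add, zero_sub,
    sub_self] <;> ring

theorem two_mul_degree (es : List (Edge L)) {v : Vertex L} (h : charge (listConfig es) v = 0) :
    2 * degree (multiplicity es) v = 0 := by
  have key : ∀ x : ZMod 3 → ZMod 2, ∑ k, x k = 0 → ∑ k, 2 * lift (x k) = 0 := by decide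
  rw [degree, Finset.mul_sum]
  simp only [← two_mul_lift_listConfig]
  exact key _ h

namespace Path

theorem four_mul_eq_zero : ∀ a : ZMod 4, 4 * a = 0 := by decide

/-- The linking number with an initial part of a path is determined by any dual path along this
part: the dual path may be pushed to the left of the path, and the remainder telescopes. -/
theorem DualRun.dualExp_eq (hL : Generic L) {P : Path L} (fs' : List (Edge L))
    (hcharge : ∀ v ∈ P.vertexSet, charge (listConfig fs') v = 0) {m₀ : ZMod 3} {t : ℕ}
    {p : Plaquette L} {fs : List (Edge L)} (h : DualRun P (plaq P.start m₀) t p fs) :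
    t ≤ P.len ∧ ∃ m, plaq (P.vert t) m = p ∧
      dualExp fs (listConfig fs') + 2 * multiplicity fs' (edgeOf (P.vert t) m)
        + 2 * multiplicity fs' (edgeOf P.start m₀) =
      ((P.edges.take t).map (linking (multiplicity fs'))).sum
        - degree (multiplicity fs') P.start + degree (multiplicity fs') (P.vert t) := by
  set N := multiplicity fs'
  have hdeg : ∀ s ≤ P.len, 2 * degree N (P.vert s) = 0 := fun s hs =>
    two_mul_degree fs' (hcharge _ (P.vert_mem hs))
  have hcases : ∀ k m : ZMod 3, m = k ∨ m = k + 1 ∨ m = k - 1 := by decide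
  induction h with
  | init _ =>
    refine ⟨Nat.zero_le _, m₀, by rw [vert_zero], ?_⟩
    rw [vert_zero]
    simp only [dualExp, List.map_nil, List.sum_nil, List.take_zero]
    linear_combination four_mul_eq_zero (N (edgeOf P.start m₀))
  | @advance t p fs _ ht hp ih =>
    obtain ⟨-, m, rfl, ih⟩ := ih
    refine ⟨ht, ?_⟩
    obtain ⟨k, hk⟩ := P.exists_label ht
    have hv := P.vert_succ hk
    have hshare : N (edgeOf (P.vert (t + 1)) k) = N (edgeOf (P.vert t) k) := by
      rw [hv, edgeOf_step]
    have hd := degree_eq N (P.vert t) k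
    have hd' := degree_eq N (P.vert (t + 1)) k
    have htake : P.edges.take (t + 1) = P.edges.take t ++ [edgeOf (P.vert t) k] := by
      rw [List.take_add_one, edges_getElem?, edge?, hk]; rfl
    have hlink := linking_edgeOf N (P.vert t) k
    rw [← hv, around, around] at hlink
    rw [htake, List.map_append, List.sum_append, List.map_singleton, List.sum_singleton, hlink]
    rcases hcases k m with rfl | rfl | rfl
    · obtain ⟨m', hm'⟩ := (mem_corners_iff _ _).mp hp
      have := hL.plaq_step_ne (P.vert (t + 1)) m m'
      rw [hv, step_step, ← hv] at this
      exact absurd hm'.symm this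
    · refine ⟨k - 1, by rw [hv, plaq_step_sub], ?_⟩
      linear_combination ih - hd - 3 * hd' + hdeg t ht.le + hdeg (t + 1) ht - 3 * hshare
        - four_mul_eq_zero (N (edgeOf (P.vert t) k))
        - four_mul_eq_zero (N (edgeOf (P.vert t) (k + 1)))
        - four_mul_eq_zero (N (edgeOf (P.vert (t + 1)) (k + 1)))
    · refine ⟨k + 1, by rw [hv, plaq_step_add], ?_⟩
      linear_combination ih - hd' + hd - hshare
  | @cross t p q f fs _ hf hfp hfq hpq ih =>
    obtain ⟨ht, m, rfl, ih⟩ := ih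
    refine ⟨ht, ?_⟩
    obtain ⟨k, rfl⟩ := hf
    obtain ⟨m₁, hm₁, h₁⟩ := (edgeOf_mem_boundary_iff _ _ _).mp hfp
    obtain rfl := hL.plaq_injective _ h₁
    obtain ⟨m', hm', rfl⟩ := (edgeOf_mem_boundary_iff _ _ _).mp hfq
    have hne : m₁ ≠ m' := fun h => hpq (by rw [h])
    refine ⟨m', rfl, ?_⟩
    have hd := degree_eq N (P.vert t) k
    have hz : dualExp (edgeOf (P.vert t) k :: fs) (listConfig fs') =
        2 * N (edgeOf (P.vert t) k) + dualExp fs (listConfig fs') := by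
      rw [dualExp, List.map_cons, List.sum_cons, two_mul_lift_listConfig]; rfl
    rw [hz]
    rcases hcases k m₁ with rfl | rfl | rfl
    · exact absurd rfl hm₁
    · rcases hcases k m' with rfl | rfl | rfl
      · exact absurd rfl hm'
      · exact absurd rfl hne
      · linear_combination ih + hdeg t ht - 2 * hd - four_mul_eq_zero (N (edgeOf (P.vert t) (k + 1)))
    · rcases hcases k m' with rfl | rfl | rfl
      · exact absurd rfl hm'
      · linear_combination ih + hdeg t ht - 2 * hd - four_mul_eq_zero (N (edgeOf (P.vert t) (k - 1)))
      · exact absurd rfl hne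

/-- The dual path of `P` sees the edges of `Q` as often as `P` and `Q` are linked. -/
theorem IsDualPath.dualExp_eq (hL : Generic L) {P Q : Path L} (hPQ : P.Cross Q)
    {fs : List (Edge L)} (h : P.IsDualPath fs) :
    dualExp fs (listConfig Q.edges) = listLinking P.edges Q.edges := by
  obtain ⟨p, q, hrun, hclosed, -⟩ := h
  have hstart : ∀ {t q fs}, DualRun P p t q fs → P.start ∈ corners p := by
    intro t q fs h
    induction h with
    | init h => exact h
    | advance _ _ _ ih => exact ih
    | cross _ _ _ _ _ ih => exact ih
  obtain ⟨m₀, rfl⟩ := (mem_corners_iff _ _).mp (hstart hrun)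
  obtain ⟨-, m, hm, h⟩ := hrun.dualExp_eq hL Q.edges
    fun v hv => charge_listConfig_edges hPQ hv
  have htake : P.edges.take P.len = P.edges := by
    exact List.take_of_length_le P.edges_length.le
  rw [htake] at h
  change plaq P.finish m = q at hm
  change _ + 2 * multiplicity _ (edgeOf P.finish m) + _ = _ + degree _ P.finish at h
  rw [listLinking]
  by_cases hP : P.IsClosed
  · have hfin : P.finish = P.start := Eq.symm hP
    rw [hfin] at h hm
    rw [← hclosed hP] at hm
    obtain rfl := hL.plaq_injective _ hm
    linear_combination h - four_mul_eq_zero (multiplicity Q.edges (edgeOf P.start m))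
  · obtain ⟨h1, h2⟩ := hPQ.1 hP
    have zero_of : ∀ v ∉ Q.vertexSet, ∀ k, multiplicity Q.edges (edgeOf v k) = 0 :=
      fun v hv k => multiplicity_of_not_mem fun h => hv (mem_vertexSet_of_mem_edges h)
    have d1 : degree (multiplicity Q.edges) P.start = 0 :=
      Finset.sum_eq_zero fun k _ => zero_of _ h1 k
    have d2 : degree (multiplicity Q.edges) P.finish = 0 :=
      Finset.sum_eq_zero fun k _ => zero_of _ h2 k
    rw [zero_of _ h1, zero_of _ h2, d1, d2] at h
    linear_combination h

end Path

/-! ### Runs along a cyclic direction of a finite group -/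

section Runs

variable {X : Type*} [AddCommGroup X]

theorem exists_run_end [Finite X] (g : X) (E : X → Prop) (x : X) (h : ¬ E (x - g)) :
    ∃ ℓ : ℕ, (∀ k < ℓ, E (x + k • g)) ∧ ¬ E (x + ℓ • g) := by
  classical
  have hex : ∃ ℓ : ℕ, ¬ E (x + ℓ • g) := by
    refine ⟨addOrderOf g - 1, ?_⟩
    have h1 : (addOrderOf g - 1) • g = -g := by
      rw [eq_neg_iff_add_eq_zero, ← succ_nsmul, Nat.sub_add_cancel (addOrderOf_pos g),
        addOrderOf_nsmul_eq_zero]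
    rwa [h1, ← sub_eq_add_neg]
  exact ⟨Nat.find hex, fun k hk => not_not.mp (Nat.find_min hex hk), Nat.find_spec hex⟩

theorem run_end_unique {g : X} {E : X → Prop} {x : X} {ℓ ℓ' : ℕ}
    (h : ∀ k < ℓ, E (x + k • g)) (h₁ : ¬ E (x + ℓ • g))
    (h' : ∀ k < ℓ', E (x + k • g)) (h₁' : ¬ E (x + ℓ' • g)) : ℓ = ℓ' := by
  rcases lt_trichotomy ℓ ℓ' with hlt | heq | hlt
  · exact absurd (h' _ hlt) h₁
  · exact heq
  · exact absurd (h _ hlt) h₁'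

/-- Every run has one end, and every end belongs to one run. -/
theorem sum_run_ends {M : Type*} [AddCommMonoid M] [Fintype X] (g : X) (E : X → Prop)
    [DecidablePred E] (f : X → M) (ℓ : X → ℕ)
    (hℓ : ∀ x, ¬ E (x - g) → (∀ k < ℓ x, E (x + k • g)) ∧ ¬ E (x + ℓ x • g)) :
    ∑ x with E x ∧ ¬ E (x - g), f (x + ℓ x • g) = ∑ y with ¬ E y ∧ E (y - g), f y := by
  have pos : ∀ x, E x → ¬ E (x - g) → 0 < ℓ x := by
    intro x hx hx'
    by_contra h0
    have := (hℓ x hx').2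
    rw [Nat.eq_zero_of_not_pos h0, zero_nsmul, add_zero] at this
    exact this hx
  refine Finset.sum_bij (fun x _ => x + ℓ x • g) ?_ ?_ ?_ fun _ _ => rfl
  · intro x hx
    rw [Finset.mem_filter_univ] at hx ⊢
    refine ⟨(hℓ x hx.2).2, ?_⟩
    have hp := pos x hx.1 hx.2
    have := (hℓ x hx.2).1 (ℓ x - 1) (by omega)
    have h2 : ℓ x • g = (ℓ x - 1) • g + g := by rw [← succ_nsmul, Nat.sub_add_cancel hp]
    rwa [h2, ← add_assoc, add_sub_cancel_right]
  · have key : ∀ x x', E x → ¬ E (x - g) → E x' → ¬ E (x' - g) →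
        x + ℓ x • g = x' + ℓ x' • g → ¬ ℓ x < ℓ x' := by
      intro x x' _ hx2 _ hx2' h hlt
      have h3 := (hℓ x' hx2').1 (ℓ x' - ℓ x - 1) (by omega)
      apply hx2
      have h4 : x = x' + (ℓ x' - ℓ x) • g := by
        have : ℓ x' • g = (ℓ x' - ℓ x) • g + ℓ x • g := by rw [← add_nsmul]; congr 1; omega
        rw [this, ← add_assoc] at h
        exact add_right_cancel h
      have h5 : (ℓ x' - ℓ x) • g = (ℓ x' - ℓ x - 1) • g + g := by
        rw [← succ_nsmul]; congr 1; omega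
      rw [h4, h5, ← add_assoc, add_sub_cancel_right]
      exact h3
    intro x hx x' hx' h
    rw [Finset.mem_filter_univ] at hx hx'
    have h1 := key x x' hx.1 hx.2 hx'.1 hx'.2 h
    have h2 := key x' x hx'.1 hx'.2 hx.1 hx.2 h.symm
    have h3 : ℓ x = ℓ x' := by omega
    simp only [h3] at h
    exact add_right_cancel h
  · intro y hy
    rw [Finset.mem_filter_univ] at hy
    obtain ⟨n, h1, h2⟩ := exists_run_end (-g) E (y - g) (by simpa using hy.1)
    have hn : 0 < n := by
      by_contra h0
      rw [Nat.eq_zero_of_not_pos h0, zero_nsmul, add_zero] at h2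
      exact h2 hy.2
    have hback : ∀ k < n, E (y - n • g + k • g) := by
      intro k hk
      have h3 := h1 (n - 1 - k) (by omega)
      have h4 : n • g = (n - 1 - k) • g + g + k • g := by
        rw [← succ_nsmul, ← add_nsmul]; congr 1; omega
      rw [h4]
      convert h3 using 1
      rw [neg_nsmul]; abel
    have hstart : E (y - n • g) := by simpa using hback 0 hn
    have hstart' : ¬ E (y - n • g - g) := by
      convert h2 using 2
      rw [neg_nsmul]; abel
    have hlen : ℓ (y - n • g) = n :=
      run_end_unique (hℓ _ hstart').1 (hℓ _ hstart').2 hback (by simpa using hy.1)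
    refine ⟨y - n • g, ?_, ?_⟩
    · rw [Finset.mem_filter_univ]; exact ⟨hstart, hstart'⟩
    · rw [hlen, sub_add_cancel]

end Runs

/-! ### Paths with cyclic indices -/

/-- The residues modulo `n` are represented by the numbers below `n`. -/
def finEquivZMod (n : ℕ) [NeZero n] : Fin n ≃ ZMod n where
  toFun a := ((a : ℕ) : ZMod n)
  invFun s := ⟨s.val, s.val_lt⟩
  left_inv a := Fin.ext (ZMod.val_natCast_of_lt a.2)
  right_inv s := ZMod.natCast_zmod_val s

theorem val_add_one_eq {n : ℕ} [NeZero n] (s : ZMod n) : (s + 1).val = (s.val + 1) % n := by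
  rw [← ZMod.val_natCast, Nat.cast_add, ZMod.natCast_zmod_val, Nat.cast_one]

namespace Path

/-- The vertex of a path of length `n` with a given cyclic index. -/
def cycVert (P : Path L) {n : ℕ} (s : ZMod n) : Vertex L := P.vert s.val

/-- The label that follows the vertex with a given cyclic index. -/
def cycLabel (P : Path L) {n : ℕ} (s : ZMod n) : ZMod 3 := P.labels[s.val]?.getD 0

variable {P Q : Path L} {p q : ℕ}

theorem labels_getElem?_val [NeZero p] (hp : P.len = p) (s : ZMod p) :
    P.labels[s.val]? = some (P.cycLabel s) := by
  obtain ⟨k, hk⟩ := P.exists_label (hp ▸ s.val_lt : s.val < P.len)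
  rw [cycLabel, hk]; rfl

theorem cycVert_mem [NeZero p] (hp : P.len = p) (s : ZMod p) : P.cycVert s ∈ P.vertexSet :=
  P.vert_mem (hp ▸ s.val_lt.le)

theorem vert_val_add_one [NeZero p] (hp : P.len = p) (s : ZMod p) :
    P.vert (s.val + 1) = step (P.cycVert s) (P.cycLabel s) :=
  P.vert_succ (labels_getElem?_val hp s)

theorem head_mem [NeZero p] (hp : P.len = p) (s : ZMod p) :
    step (P.cycVert s) (P.cycLabel s) ∈ P.vertexSet := by
  rw [← vert_val_add_one hp]
  exact P.vert_mem (hp ▸ s.val_lt)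

/-- Off the end points of open paths, the cyclic successor of an index is the next vertex. -/
theorem head_eq_iff [NeZero p] (hp : P.len = p) {V : Set (Vertex L)}
    (hV : P.IsOpen → P.start ∉ V ∧ P.finish ∉ V) (s : ZMod p) {v : Vertex L} (hv : v ∈ V) :
    step (P.cycVert s) (P.cycLabel s) = v ↔ P.cycVert (s + 1) = v := by
  rw [← vert_val_add_one hp, cycVert, val_add_one_eq]
  have hs : s.val < p := s.val_lt
  rcases Nat.lt_or_ge (s.val + 1) p with h | h
  · rw [Nat.mod_eq_of_lt h]
  · have h1 : s.val + 1 = p := by omega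
    rw [h1, Nat.mod_self, vert_zero]
    have h2 : P.vert p = P.finish := by rw [finish, hp]
    rw [h2]
    by_cases hc : P.IsClosed
    · rw [← show P.start = P.finish from hc]
    · obtain ⟨h3, h4⟩ := hV hc
      exact iff_of_false (fun h => h4 (h ▸ hv)) (fun h => h3 (h ▸ hv))

/-- The paths meet at a pair of cyclic indices. -/
def Meet (P Q : Path L) (x : ZMod p × ZMod q) : Prop := P.cycVert x.1 = Q.cycVert x.2

/-- The paths meet at a pair of cyclic indices and run in the same direction along the next
edge. -/
def Common (P Q : Path L) (x : ZMod p × ZMod q) : Prop :=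
  Meet P Q x ∧ P.cycLabel x.1 = Q.cycLabel x.2

theorem heads_eq_iff [NeZero p] [NeZero q] (h : P.Cross Q) (hp : P.len = p) (hq : Q.len = q) (x : ZMod p × ZMod q) :
    step (P.cycVert x.1) (P.cycLabel x.1) = step (Q.cycVert x.2) (Q.cycLabel x.2) ↔
      Meet P Q (x + 1) := by
  rw [head_eq_iff hp h.1 _ (head_mem hq x.2), eq_comm,
    head_eq_iff hq h.2 _ (cycVert_mem hp (x.1 + 1)), eq_comm]
  rfl

theorem Common.meet_add_one [NeZero p] [NeZero q] (h : P.Cross Q) (hp : P.len = p) (hq : Q.len = q)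
    {x : ZMod p × ZMod q} (hx : Common P Q x) : Meet P Q (x + 1) := by
  rw [← heads_eq_iff h hp hq, show P.cycVert x.1 = Q.cycVert x.2 from hx.1, hx.2]

theorem common_sub_one_iff [NeZero p] [NeZero q] (h : P.Cross Q) (hp : P.len = p) (hq : Q.len = q)
    (x : ZMod p × ZMod q) :
    Common P Q (x - 1) ↔ Meet P Q x ∧ P.cycLabel (x.1 - 1) = Q.cycLabel (x.2 - 1) := by
  constructor
  · intro hx
    have := hx.meet_add_one h hp hq
    rw [sub_add_cancel] at this
    exact ⟨this, hx.2⟩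
  · rintro ⟨h1, h2⟩
    refine ⟨?_, h2⟩
    rw [← sub_add_cancel x 1, ← heads_eq_iff h hp hq] at h1
    have h3 : P.cycLabel (x - 1).1 = Q.cycLabel (x - 1).2 := h2
    rw [h3] at h1
    have h4 := congrArg (fun v => step v (Q.cycLabel (x - 1).2)) h1
    simp only [step_step] at h4
    exact h4

/-! ### Crossings in terms of cyclic indices -/

/-- The integers that are indices of edges of a path: all of them if it is closed. -/
def IsIndex (P : Path L) (i : ℤ) : Prop := P.IsClosed ∨ (0 ≤ i ∧ i < P.len)

theorem toNat_emod [NeZero p] (i : ℤ) : (i % (p : ℤ)).toNat = ((i : ZMod p)).val := by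
  have := ZMod.val_intCast (n := p) i
  omega

theorem IsIndex.toNat_eq [NeZero p] (hp : P.len = p) {i : ℤ} (hi : 0 ≤ i ∧ i < P.len) :
    i.toNat = ((i : ZMod p)).val := by
  rw [← toNat_emod, Int.emod_eq_of_lt hi.1 (hp ▸ hi.2)]

theorem IsIndex.labelAt_eq [NeZero p] (hp : P.len = p) {i : ℤ} (hi : P.IsIndex i) :
    P.labelAt i = some (P.cycLabel (i : ZMod p)) := by
  rw [← labels_getElem?_val hp, labelAt]
  split_ifs with h1 h2
  · rw [← toNat_emod, hp]
  · rw [IsIndex.toNat_eq hp (hi.resolve_left h1)]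
  · exact absurd (hi.resolve_left h1).1 h2

theorem IsIndex.vertAt_eq [NeZero p] (hp : P.len = p) {i : ℤ} (hi : P.IsIndex i) :
    P.vertAt i = P.cycVert (i : ZMod p) := by
  rw [cycVert, vertAt]
  split_ifs with h1
  · rw [← toNat_emod, hp]
  · rw [IsIndex.toNat_eq hp (hi.resolve_left h1)]

theorem isIndex_of_labelAt {i : ℤ} {d : ZMod 3} (h : P.labelAt i = some d) : P.IsIndex i := by
  rw [labelAt] at h
  split_ifs at h with h1 h2
  · exact Or.inl h1
  · have := P.lt_len h
    exact Or.inr ⟨h2, by omega⟩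

theorem IsIndex.add_one (hp : P.len = p) {V : Set (Vertex L)}
    (hV : P.IsOpen → P.start ∉ V ∧ P.finish ∉ V) {i : ℤ} (hi : P.IsIndex i)
    (h : P.cycVert ((i + 1 : ℤ) : ZMod p) ∈ V) : P.IsIndex (i + 1) := by
  by_cases hc : P.IsClosed
  · exact Or.inl hc
  · have h1 := hi.resolve_left hc
    refine Or.inr ⟨by omega, ?_⟩
    by_contra h2
    have h3 : i + 1 = (p : ℤ) := by omega
    rw [h3, cycVert, Int.cast_natCast, ZMod.natCast_self, ZMod.val_zero, vert_zero] at h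
    exact (hV hc).1 h

theorem IsIndex.sub_one {V : Set (Vertex L)}
    (hV : P.IsOpen → P.start ∉ V ∧ P.finish ∉ V) {i : ℤ} (hi : P.IsIndex i)
    (h : P.cycVert (i : ZMod p) ∈ V) : P.IsIndex (i - 1) := by
  by_cases hc : P.IsClosed
  · exact Or.inl hc
  · have h1 := hi.resolve_left hc
    refine Or.inr ⟨?_, by omega⟩
    by_contra h2
    have h3 : i = 0 := by omega
    rw [h3, cycVert, Int.cast_zero, ZMod.val_zero, vert_zero] at h
    exact (hV hc).1 h

theorem isIndex_val [NeZero p] (hp : P.len = p) (s : ZMod p) : P.IsIndex (s.val : ℤ) :=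
  Or.inr ⟨by omega, by have := s.val_lt; omega⟩

theorem add_nsmul_one_fst [NeZero p] (x : ZMod p × ZMod q) (k : ℕ) :
    (x + k • (1 : ZMod p × ZMod q)).1 = (((x.1.val : ℤ) + k : ℤ) : ZMod p) := by
  simp

theorem add_nsmul_one_snd [NeZero q] (x : ZMod p × ZMod q) (k : ℕ) :
    (x + k • (1 : ZMod p × ZMod q)).2 = (((x.2.val : ℤ) + k : ℤ) : ZMod q) := by
  simp

theorem sub_one_fst [NeZero p] (x : ZMod p × ZMod q) :
    (x - 1).1 = (((x.1.val : ℤ) - 1 : ℤ) : ZMod p) := by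
  simp

theorem sub_one_snd [NeZero q] (x : ZMod p × ZMod q) :
    (x - 1).2 = (((x.2.val : ℤ) - 1 : ℤ) : ZMod q) := by
  simp

/-- The two relative orientations at the ends of the run of common edges that starts at `x` and
comprises `ℓ` edges are the same. -/
def SameSide (P Q : Path L) (x : ZMod p × ZMod q) (ℓ : ℕ) : Prop :=
  Counterclockwise (P.cycLabel (x - 1).1) (Q.cycLabel (x - 1).2) ↔
    Counterclockwise (P.cycLabel (x + ℓ • (1 : ZMod p × ZMod q)).1)
      (Q.cycLabel (x + ℓ • (1 : ZMod p × ZMod q)).2)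

theorem CrossesOver.common [NeZero p] [NeZero q] (hp : P.len = p) (hq : Q.len = q)
    {x : ZMod p × ZMod q} {ℓ : ℕ} (h : P.CrossesOver Q (x.1.val : ℤ) (x.2.val : ℤ) ℓ) :
    Common P Q x ∧ ¬ Common P Q (x - 1) ∧
      (∀ k < ℓ, Common P Q (x + k • (1 : ZMod p × ZMod q))) ∧
      ¬ Common P Q (x + ℓ • (1 : ZMod p × ZMod q)) ∧ SameSide P Q x ℓ := by
  obtain ⟨h1, hvert, hlab, d₁, d₁', d₂, d₂', e1, e1', hd, e2, e2', hd', hside⟩ := h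
  have run : ∀ k < ℓ, Common P Q (x + k • (1 : ZMod p × ZMod q)) := by
    intro k hk
    obtain ⟨d, hdP, hdQ⟩ := hlab k hk
    have iP := isIndex_of_labelAt hdP
    have iQ := isIndex_of_labelAt hdQ
    have hv := hvert k hk.le
    rw [iP.vertAt_eq hp, iQ.vertAt_eq hq] at hv
    rw [iP.labelAt_eq hp] at hdP
    rw [iQ.labelAt_eq hq] at hdQ
    refine ⟨?_, ?_⟩
    · rw [Meet, add_nsmul_one_fst, add_nsmul_one_snd]; exact hv
    · rw [add_nsmul_one_fst, add_nsmul_one_snd]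
      exact (Option.some.inj hdP).trans (Option.some.inj hdQ).symm
  rw [(isIndex_of_labelAt e1).labelAt_eq hp, Option.some.injEq, ← sub_one_fst] at e1
  rw [(isIndex_of_labelAt e1').labelAt_eq hq, Option.some.injEq, ← sub_one_snd] at e1'
  rw [(isIndex_of_labelAt e2).labelAt_eq hp, Option.some.injEq, ← add_nsmul_one_fst] at e2
  rw [(isIndex_of_labelAt e2').labelAt_eq hq, Option.some.injEq, ← add_nsmul_one_snd] at e2'
  refine ⟨by simpa using run 0 h1, fun h => hd ?_, run, fun h => hd' ?_, ?_⟩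
  · rw [← e1, ← e1']; exact h.2
  · rw [← e2, ← e2']; exact h.2
  · rw [SameSide, e1, e1', e2, e2']; exact hside

theorem crossesOver_of_run [NeZero p] [NeZero q] (hPQ : P.Cross Q) (hp : P.len = p) (hq : Q.len = q)
    {x : ZMod p × ZMod q} {ℓ : ℕ} (hx : Common P Q x) (hx' : ¬ Common P Q (x - 1))
    (hrun : ∀ k < ℓ, Common P Q (x + k • (1 : ZMod p × ZMod q)))
    (hend : ¬ Common P Q (x + ℓ • (1 : ZMod p × ZMod q))) (hside : SameSide P Q x ℓ) :
    P.CrossesOver Q (x.1.val : ℤ) (x.2.val : ℤ) ℓ := by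
  have hℓ : 1 ≤ ℓ := by
    by_contra h0
    have h0 : ℓ = 0 := by omega
    rw [h0, zero_nsmul, add_zero] at hend
    exact hend hx
  have meet : ∀ k ≤ ℓ, Meet P Q (x + k • (1 : ZMod p × ZMod q)) := by
    intro k hk
    rcases Nat.lt_or_ge k ℓ with h | h
    · exact (hrun k h).1
    · have hk' : k = (ℓ - 1) + 1 := by omega
      rw [hk', succ_nsmul, ← add_assoc]
      exact (hrun (ℓ - 1) (by omega)).meet_add_one hPQ hp hq
  have index : ∀ k ≤ ℓ, P.IsIndex ((x.1.val : ℤ) + k) ∧ Q.IsIndex ((x.2.val : ℤ) + k) := by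
    intro k
    induction k with
    | zero =>
      intro _
      rw [Nat.cast_zero, add_zero, add_zero]
      exact ⟨isIndex_val hp x.1, isIndex_val hq x.2⟩
    | succ k ih =>
      intro hk
      obtain ⟨i1, i2⟩ := ih (by omega)
      have hm : P.cycVert _ = Q.cycVert _ := meet (k + 1) hk
      have hP := cycVert_mem hp (x + (k + 1) • (1 : ZMod p × ZMod q)).1
      have hQ := cycVert_mem hq (x + (k + 1) • (1 : ZMod p × ZMod q)).2
      rw [← hm] at hQ
      rw [hm] at hP
      rw [add_nsmul_one_fst, Nat.cast_add, Nat.cast_one, ← add_assoc] at hQ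
      rw [add_nsmul_one_snd, Nat.cast_add, Nat.cast_one, ← add_assoc] at hP
      rw [Nat.cast_add, Nat.cast_one, ← add_assoc, ← add_assoc]
      exact ⟨i1.add_one hp hPQ.1 hQ, i2.add_one hq hPQ.2 hP⟩
  have m0 : P.cycVert x.1 = Q.cycVert x.2 := hx.1
  have cast1 : (((x.1.val : ℤ) : ℤ) : ZMod p) = x.1 := by simp
  have cast2 : (((x.2.val : ℤ) : ℤ) : ZMod q) = x.2 := by simp
  have j1 : P.IsIndex ((x.1.val : ℤ) - 1) := (isIndex_val hp x.1).sub_one (p := p) hPQ.1 (by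
    rw [cast1, m0]; exact cycVert_mem hq _)
  have j2 : Q.IsIndex ((x.2.val : ℤ) - 1) := (isIndex_val hq x.2).sub_one (p := q) hPQ.2 (by
    rw [cast2, ← m0]; exact cycVert_mem hp _)
  refine ⟨hℓ, fun k hk => ?_, fun k hk => ⟨_, (index k hk.le).1.labelAt_eq hp, ?_⟩, _, _, _, _,
    j1.labelAt_eq hp, j2.labelAt_eq hq, ?_, (index ℓ le_rfl).1.labelAt_eq hp,
    (index ℓ le_rfl).2.labelAt_eq hq, ?_, ?_⟩
  · rw [(index k hk).1.vertAt_eq hp, (index k hk).2.vertAt_eq hq, ← add_nsmul_one_fst,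
      ← add_nsmul_one_snd]
    exact meet k hk
  · rw [(index k hk.le).2.labelAt_eq hq, ← add_nsmul_one_fst, ← add_nsmul_one_snd]
    exact congrArg some (hrun k hk).2.symm
  · rw [← sub_one_fst, ← sub_one_snd]
    exact fun h => hx' ((common_sub_one_iff hPQ hp hq x).mpr ⟨hx.1, h⟩)
  · rw [← add_nsmul_one_fst, ← add_nsmul_one_snd]
    exact fun h => hend ⟨meet ℓ le_rfl, h⟩
  · rw [← sub_one_fst, ← sub_one_snd, ← add_nsmul_one_fst, ← add_nsmul_one_snd]
    exact hside

end Path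

namespace Path

variable {P Q : Path L} {p q : ℕ}

/-! ### Counting crossings modulo four -/

theorem turn_add_turn : ∀ a a' b b' : ZMod 3, a ≠ a' → b ≠ b' →
    turn a a' + turn b b' = if (a' = a + 1 ↔ b' = b + 1) then 2 else 0 := by decide

open Classical in
/-- Each crossing contributes two equal orientations at the ends of a common run, and the
orientations at the ends of the other common runs cancel. -/
theorem two_mul_parallelCrossings [NeZero p] [NeZero q] (h : P.Cross Q) (hp : P.len = p)
    (hq : Q.len = q) :
    (2 * P.parallelCrossings Q : ZMod 4) = ∑ x : ZMod p × ZMod q, if Meet P Q x then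
      (if P.cycLabel x.1 = Q.cycLabel x.2 then
        turn (P.cycLabel (x.1 - 1)) (Q.cycLabel (x.2 - 1)) else 0) +
      (if P.cycLabel (x.1 - 1) = Q.cycLabel (x.2 - 1) then
        turn (P.cycLabel x.1) (Q.cycLabel x.2) else 0) else 0 := by
  have hex : ∀ x : ZMod p × ZMod q, ∃ ℓ : ℕ, ¬ Common P Q (x - 1) →
      (∀ k < ℓ, Common P Q (x + k • (1 : ZMod p × ZMod q))) ∧
        ¬ Common P Q (x + ℓ • (1 : ZMod p × ZMod q)) := by
    intro x
    by_cases hx : Common P Q (x - 1)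
    · exact ⟨0, fun h => absurd hx h⟩
    · obtain ⟨ℓ, hℓ⟩ := exists_run_end 1 (Common P Q) x hx
      exact ⟨ℓ, fun _ => hℓ⟩
  choose ℓ hℓ using hex
  have hcount : P.parallelCrossings Q = Finset.card
      {x : ZMod p × ZMod q | (Common P Q x ∧ ¬ Common P Q (x - 1)) ∧ SameSide P Q x (ℓ x)} := by
    have hiff : ∀ x : ZMod p × ZMod q,
        (∃ n : ℕ, P.CrossesOver Q (x.1.val : ℤ) (x.2.val : ℤ) n) ↔
        (Common P Q x ∧ ¬ Common P Q (x - 1)) ∧ SameSide P Q x (ℓ x) := by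
      intro x
      constructor
      · rintro ⟨n, hn⟩
        obtain ⟨h1, h2, h3, h4, h5⟩ := hn.common hp hq
        rw [run_end_unique (hℓ x h2).1 (hℓ x h2).2 h3 h4]
        exact ⟨⟨h1, h2⟩, h5⟩
      · rintro ⟨⟨h1, h2⟩, h5⟩
        exact ⟨ℓ x, crossesOver_of_run h hp hq h1 h2 (hℓ x h2).1 (hℓ x h2).2 h5⟩
    subst hp hq
    rw [parallelCrossings, ← Fintype.card_subtype, ← Nat.card_eq_fintype_card]
    refine Nat.card_congr (Equiv.subtypeEquiv
      ((finEquivZMod P.len).prodCongr (finEquivZMod Q.len)) fun ab => ?_)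
    rw [← hiff]
    have e1 : ((finEquivZMod P.len).prodCongr (finEquivZMod Q.len) ab).1.val = (ab.1 : ℕ) :=
      ZMod.val_natCast_of_lt ab.1.2
    have e2 : ((finEquivZMod P.len).prodCongr (finEquivZMod Q.len) ab).2.val = (ab.2 : ℕ) :=
      ZMod.val_natCast_of_lt ab.2.2
    rw [e1, e2]
  have hends := sum_run_ends 1 (Common P Q)
    (fun x : ZMod p × ZMod q => turn (P.cycLabel x.1) (Q.cycLabel x.2)) ℓ hℓ
  have hpair : ∀ x : ZMod p × ZMod q, Common P Q x ∧ ¬ Common P Q (x - 1) →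
      (if SameSide P Q x (ℓ x) then (2 : ZMod 4) else 0) =
        turn (P.cycLabel (x.1 - 1)) (Q.cycLabel (x.2 - 1)) +
        turn (P.cycLabel (x + ℓ x • (1 : ZMod p × ZMod q)).1)
          (Q.cycLabel (x + ℓ x • (1 : ZMod p × ZMod q)).2) := by
    rintro x ⟨h1, h2⟩
    have hpos : 0 < ℓ x := by
      by_contra h0
      have := (hℓ x h2).2
      rw [Nat.eq_zero_of_not_pos h0, zero_nsmul, add_zero] at this
      exact this h1
    rw [turn_add_turn]
    · exact if_congr Iff.rfl rfl rfl
    · exact fun h' => h2 ((common_sub_one_iff h hp hq x).mpr ⟨h1.1, h'⟩)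
    · refine fun h' => (hℓ x h2).2 ⟨?_, h'⟩
      have := ((hℓ x h2).1 (ℓ x - 1) (by omega)).meet_add_one h hp hq
      rwa [add_assoc, ← succ_nsmul, Nat.sub_add_cancel hpos] at this
  have hsum : (2 * P.parallelCrossings Q : ZMod 4) =
      ∑ x : ZMod p × ZMod q with Common P Q x ∧ ¬ Common P Q (x - 1),
        (if SameSide P Q x (ℓ x) then (2 : ZMod 4) else 0) := by
    rw [hcount, ← Finset.sum_filter, Finset.filter_filter, Finset.sum_const, nsmul_eq_mul, mul_comm]
  rw [hsum, Finset.sum_congr rfl fun x hx => hpair x ((Finset.mem_filter_univ x).mp hx),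
    Finset.sum_add_distrib, hends, Finset.sum_filter, Finset.sum_filter, ← Finset.sum_add_distrib]
  refine Finset.sum_congr rfl fun x _ => ?_
  have hc := common_sub_one_iff h hp hq x
  by_cases hm : Meet P Q x
  · rw [if_pos hm]
    have hx : Common P Q x ↔ P.cycLabel x.1 = Q.cycLabel x.2 := ⟨fun h => h.2, fun h => ⟨hm, h⟩⟩
    have hx' : Common P Q (x - 1) ↔ P.cycLabel (x.1 - 1) = Q.cycLabel (x.2 - 1) := by
      rw [hc]; exact ⟨fun h => h.2, fun h => ⟨hm, h⟩⟩
    rw [hx, hx']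
    by_cases h1 : P.cycLabel x.1 = Q.cycLabel x.2 <;>
      by_cases h2 : P.cycLabel (x.1 - 1) = Q.cycLabel (x.2 - 1) <;>
      simp [h1, h2, turn_self]
  · have h1 : ¬ Common P Q x := fun h => hm h.1
    have h2 : ¬ Common P Q (x - 1) := fun h => hm (hc.mp h).1
    simp [hm, h1, h2]

/-! ### Reversal -/

theorem reverse_len (Q : Path L) : Q.reverse.len = Q.len := List.length_reverse

/-- The vertices of the reversed path are met in the opposite order. -/
theorem reverse_vert (Q : Path L) (i : ℕ) (hi : i ≤ Q.len) :
    Q.reverse.vert i = Q.vert (Q.len - i) := by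
  induction i with
  | zero => rw [vert_zero]; rfl
  | succ i ih =>
    obtain ⟨k, hk⟩ := Q.exists_label (i := Q.len - (i + 1)) (by omega)
    have hk' : Q.reverse.labels[i]? = some k := by
      rw [← hk, reverse, List.getElem?_reverse (by exact hi)]
      congr 1
      change Q.len - 1 - i = _
      omega
    have hv := Q.vert_succ hk
    rw [show Q.len - (i + 1) + 1 = Q.len - i by omega] at hv
    rw [vert_succ _ hk', ih (by omega), hv, step_step]

theorem reverse_finish (Q : Path L) : Q.reverse.finish = Q.start := by
  rw [finish, reverse_len, reverse_vert _ _ le_rfl, Nat.sub_self, vert_zero]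

theorem reverse_vertexSet (Q : Path L) : Q.reverse.vertexSet = Q.vertexSet := by
  ext v
  constructor
  · rintro ⟨i, hi, rfl⟩
    rw [reverse_len] at hi
    rw [reverse_vert _ _ hi]
    exact Q.vert_mem (by omega)
  · rintro ⟨i, hi, rfl⟩
    refine ⟨Q.len - i, by rw [reverse_len]; omega, ?_⟩
    rw [reverse_vert _ _ (by omega), Nat.sub_sub_self hi]

theorem reverse_isOpen (Q : Path L) : Q.reverse.IsOpen ↔ Q.IsOpen := by
  rw [IsOpen, IsOpen, IsClosed, IsClosed, reverse_finish, eq_comm]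
  rfl

theorem Cross.reverse (h : P.Cross Q) : P.Cross Q.reverse := by
  refine ⟨?_, ?_⟩
  · rw [reverse_vertexSet]; exact h.1
  · rw [reverse_isOpen, reverse_finish]
    exact fun ho => (h.2 ho).symm

theorem reverse_cycLabel [NeZero q] (hq : Q.len = q) (t : ZMod q) :
    Q.reverse.cycLabel t = Q.cycLabel (-t - 1) := by
  have ht := t.val_lt
  have hval : (-t - 1 : ZMod q).val = q - 1 - t.val := by
    have : (-t - 1 : ZMod q) = ((q - 1 - t.val : ℕ) : ZMod q) := by
      rw [Nat.cast_sub (by omega), Nat.cast_sub (by omega), ZMod.natCast_zmod_val,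
        ZMod.natCast_self, Nat.cast_one]
      ring
    rw [this, ZMod.val_natCast_of_lt (by omega)]
  rw [cycLabel, cycLabel, hval, reverse, List.getElem?_reverse (by exact hq ▸ ht)]
  congr 2
  change Q.len - 1 - _ = _
  rw [hq]

theorem meet_reverse_iff [NeZero p] [NeZero q] (h : P.Cross Q) (hp : P.len = p) (hq : Q.len = q)
    (s : ZMod p) (t : ZMod q) : Meet P Q.reverse (s, t) ↔ Meet P Q (s, -t) := by
  have ht := t.val_lt
  have hP := cycVert_mem hp s
  change P.cycVert s = Q.reverse.cycVert t ↔ P.cycVert s = Q.cycVert (-t)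
  have h1 : Q.reverse.cycVert t = Q.vert (q - t.val) := by
    rw [cycVert, reverse_vert _ _ (by omega), hq]
  rw [h1]
  by_cases h0 : t = 0
  · subst h0
    have h2 : Q.vert q = Q.finish := by rw [finish, hq]
    rw [neg_zero, cycVert, cycVert, ZMod.val_zero, Nat.sub_zero, vert_zero, h2]
    by_cases hc : Q.IsClosed
    · rw [← show Q.start = Q.finish from hc]
    · obtain ⟨h3, h4⟩ := h.2 hc
      exact iff_of_false (fun h => h4 (h ▸ hP)) (fun h => h3 (h ▸ hP))
  · have : NeZero t := ⟨h0⟩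
    rw [cycVert, cycVert, ZMod.val_neg_of_ne_zero]

/-! ### The linking number and the crossing number -/

theorem sum_edges [NeZero p] (hp : P.len = p) {M : Type*} [AddCommMonoid M] (f : Edge L → M) :
    (P.edges.map f).sum = ∑ s : ZMod p, f (edgeOf (P.cycVert s) (P.cycLabel s)) := by
  have hlist : P.edges = List.ofFn fun a : Fin p =>
      edgeOf (P.cycVert (finEquivZMod p a)) (P.cycLabel (finEquivZMod p a)) := by
    apply List.ext_getElem?
    intro i
    rw [edges_getElem?, edge?, List.getElem?_ofFn]
    by_cases hi : i < p
    · have hval : (finEquivZMod p ⟨i, hi⟩).val = i := ZMod.val_natCast_of_lt hi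
      have hl := labels_getElem?_val hp (finEquivZMod p ⟨i, hi⟩)
      rw [hval] at hl
      rw [dif_pos hi, hl, cycVert, hval]
      rfl
    · rw [dif_neg hi, List.getElem?_eq_none (by change P.len ≤ i; omega)]
      rfl
  rw [hlist, List.map_ofFn, List.sum_ofFn,
    ← Equiv.sum_comp (finEquivZMod p) fun s => f (edgeOf (P.cycVert s) (P.cycLabel s))]
  rfl

open Classical in
theorem around_indicator (v w : Vertex L) (k k' : ZMod 3) :
    around (indicator (edgeOf w k')) v k =
      (if v = w then turn k k' else 0) + if v = step w k' then turn k k' else 0 := by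
  by_cases h1 : v = w
  · subst h1
    rw [if_pos rfl, if_neg (step_ne v k').symm, add_zero, around_indicator_self]
  · by_cases h2 : v = step w k'
    · subst h2
      rw [if_neg h1, if_pos rfl, zero_add, ← edgeOf_step, around_indicator_self]
    · rw [if_neg h1, if_neg h2, add_zero, around_indicator_of_ne h1 h2]

theorem around_sum {ι : Type*} (S : Finset ι) (N : ι → Edge L → ZMod 4) (v : Vertex L)
    (k : ZMod 3) : around (∑ t ∈ S, N t) v k = ∑ t ∈ S, around (N t) v k := by
  simp only [around, Finset.sum_apply, Finset.sum_sub_distrib]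

/-- The orientation of two pairs of labels, at a vertex where two paths meet. -/
theorem turn_sum : ∀ x y x' y' : ZMod 3,
    turn y y' + turn y x' + (turn x y' + turn x x') =
      -(((if y = y' then turn x x' else 0) + (if x = x' then turn y y' else 0)) +
        ((if y = x' then turn x y' else 0) + (if x = y' then turn y x' else 0))) := by
  decide

open Classical in
/-- The linking number as a sum over the indices at which the paths meet. -/
theorem listLinking_eq_sum [NeZero p] [NeZero q] (h : P.Cross Q) (hp : P.len = p)
    (hq : Q.len = q) :
    listLinking P.edges Q.edges = ∑ x : ZMod p × ZMod q, if Meet P Q x then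
      turn (P.cycLabel x.1) (Q.cycLabel x.2) + turn (P.cycLabel x.1) (Q.cycLabel (x.2 - 1)) +
      (turn (P.cycLabel (x.1 - 1)) (Q.cycLabel x.2) +
        turn (P.cycLabel (x.1 - 1)) (Q.cycLabel (x.2 - 1))) else 0 := by
  have hmult : multiplicity Q.edges =
      ∑ t : ZMod q, indicator (edgeOf (Q.cycVert t) (Q.cycLabel t)) := sum_edges hq _
  rw [listLinking, sum_edges hp]
  have term : ∀ s : ZMod p,
      linking (multiplicity Q.edges) (edgeOf (P.cycVert s) (P.cycLabel s)) =
      ∑ t : ZMod q, (((if Meet P Q (s, t) then turn (P.cycLabel s) (Q.cycLabel t) else 0) +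
        (if Meet P Q (s, t + 1) then turn (P.cycLabel s) (Q.cycLabel t) else 0)) +
        ((if Meet P Q (s + 1, t) then turn (P.cycLabel s) (Q.cycLabel t) else 0) +
        (if Meet P Q (s + 1, t + 1) then turn (P.cycLabel s) (Q.cycLabel t) else 0))) := by
    intro s
    rw [linking_edgeOf, hmult, around_sum, around_sum, ← Finset.sum_add_distrib]
    refine Finset.sum_congr rfl fun t _ => ?_
    rw [around_indicator, around_indicator]
    have e1 : P.cycVert s = step (Q.cycVert t) (Q.cycLabel t) ↔ Meet P Q (s, t + 1) := by
      rw [eq_comm, head_eq_iff hq h.2 t (cycVert_mem hp s), eq_comm]; rfl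
    have e2 : step (P.cycVert s) (P.cycLabel s) = Q.cycVert t ↔ Meet P Q (s + 1, t) :=
      head_eq_iff hp h.1 s (cycVert_mem hq t)
    have e3 : step (P.cycVert s) (P.cycLabel s) = step (Q.cycVert t) (Q.cycLabel t) ↔
        Meet P Q (s + 1, t + 1) := heads_eq_iff h hp hq (s, t)
    have e0 : P.cycVert s = Q.cycVert t ↔ Meet P Q (s, t) := Iff.rfl
    simp only [e0, e1, e2, e3]
  simp only [term, Finset.sum_add_distrib]
  rw [Fintype.sum_prod_type]
  have shift₁ : ∀ f : ZMod p → ZMod 4, ∑ s, f s = ∑ s, f (s - 1) := fun f =>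
    (Equiv.sum_comp (Equiv.subRight (1 : ZMod p)) f).symm
  have shift₂ : ∀ f : ZMod q → ZMod 4, ∑ t, f t = ∑ t, f (t - 1) := fun f =>
    (Equiv.sum_comp (Equiv.subRight (1 : ZMod q)) f).symm
  have r2 : ∑ s : ZMod p, ∑ t : ZMod q,
      (if Meet P Q (s, t + 1) then turn (P.cycLabel s) (Q.cycLabel t) else 0) =
      ∑ s : ZMod p, ∑ t : ZMod q,
      (if Meet P Q (s, t) then turn (P.cycLabel s) (Q.cycLabel (t - 1)) else 0) := by
    refine Finset.sum_congr rfl fun s _ => ?_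
    rw [shift₂]
    simp only [sub_add_cancel]
  have r3 : ∑ s : ZMod p, ∑ t : ZMod q,
      (if Meet P Q (s + 1, t) then turn (P.cycLabel s) (Q.cycLabel t) else 0) =
      ∑ s : ZMod p, ∑ t : ZMod q,
      (if Meet P Q (s, t) then turn (P.cycLabel (s - 1)) (Q.cycLabel t) else 0) := by
    rw [shift₁]
    simp only [sub_add_cancel]
  have r4 : ∑ s : ZMod p, ∑ t : ZMod q,
      (if Meet P Q (s + 1, t + 1) then turn (P.cycLabel s) (Q.cycLabel t) else 0) =
      ∑ s : ZMod p, ∑ t : ZMod q,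
      (if Meet P Q (s, t) then turn (P.cycLabel (s - 1)) (Q.cycLabel (t - 1)) else 0) := by
    rw [shift₁]
    refine Finset.sum_congr rfl fun s _ => ?_
    rw [shift₂]
    simp only [sub_add_cancel]
  rw [r2, r3, r4]
  simp only [← Finset.sum_add_distrib]
  refine Finset.sum_congr rfl fun s _ => Finset.sum_congr rfl fun t _ => ?_
  split_ifs
  · rfl
  · simp

/-- The linking number of two paths modulo `4` is twice their crossing number. -/
theorem listLinking_eq_two_mul (h : P.Cross Q) (hp : 0 < P.len) (hq : 0 < Q.len) :
    listLinking P.edges Q.edges = 2 * P.crossingNumber Q := by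
  classical
  have : NeZero P.len := ⟨hp.ne'⟩
  have : NeZero Q.len := ⟨hq.ne'⟩
  have hrev : (2 * P.parallelCrossings Q.reverse : ZMod 4) =
      ∑ x : ZMod P.len × ZMod Q.len, if Meet P Q x then
        (if P.cycLabel x.1 = Q.cycLabel (x.2 - 1) then
          turn (P.cycLabel (x.1 - 1)) (Q.cycLabel x.2) else 0) +
        (if P.cycLabel (x.1 - 1) = Q.cycLabel x.2 then
          turn (P.cycLabel x.1) (Q.cycLabel (x.2 - 1)) else 0) else 0 := by
    rw [two_mul_parallelCrossings h.reverse rfl Q.reverse_len, Fintype.sum_prod_type,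
      Fintype.sum_prod_type]
    refine Finset.sum_congr rfl fun s _ => ?_
    rw [← Equiv.sum_comp (Equiv.neg (ZMod Q.len))]
    refine Finset.sum_congr rfl fun t _ => ?_
    simp only [Equiv.neg_apply, meet_reverse_iff h rfl rfl, neg_neg, reverse_cycLabel rfl, neg_sub,
      sub_neg_eq_add, add_sub_cancel_left]
  have key : listLinking P.edges Q.edges = -(2 * P.crossingNumber Q) := by
    rw [crossingNumber, Nat.cast_add, mul_add, hrev, two_mul_parallelCrossings h rfl rfl,
      listLinking_eq_sum h rfl rfl, ← Finset.sum_add_distrib, ← Finset.sum_neg_distrib]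
    refine Finset.sum_congr rfl fun x _ => ?_
    by_cases hm : Meet P Q x
    · simp only [if_pos hm]
      exact turn_sum _ _ _ _
    · simp [hm]
  rw [key]
  exact (by decide : ∀ a : ZMod 4, -(2 * a) = 2 * a) _

end Path

/-! ### Mutual statistics of the quasiparticles -/

/-- The operators `S` and `T` commute up to the factor `c`. -/
def CommuteUpTo (c : ℂ) (S T : Operator L) : Prop := S * T = c • (T * S)

namespace CommuteUpTo

variable {c d : ℂ} {S T U : Operator L}

theorem mul_left (h : CommuteUpTo c S U) (h' : CommuteUpTo d T U) :
    CommuteUpTo (c * d) (S * T) U := by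
  unfold CommuteUpTo at *
  rw [mul_assoc, h', mul_smul_comm, ← mul_assoc, h, smul_mul_assoc, smul_smul, mul_assoc,
    mul_comm d]

theorem mul_right (h : CommuteUpTo c S T) (h' : CommuteUpTo d S U) :
    CommuteUpTo (c * d) S (T * U) := by
  unfold CommuteUpTo at *
  rw [← mul_assoc, h, smul_mul_assoc, mul_assoc, h', mul_smul_comm, smul_smul, mul_assoc]

theorem symm (h : CommuteUpTo c S T) (hc : c * c = 1) : CommuteUpTo c T S := by
  unfold CommuteUpTo at *
  rw [h, smul_smul, hc, one_smul]

theorem one_left : CommuteUpTo 1 1 S := by simp [CommuteUpTo]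

theorem one_right : CommuteUpTo 1 S 1 := by simp [CommuteUpTo]

end CommuteUpTo

namespace Path

variable {P Q : Path L} {Ps Qs : List (Path L)} {n : ℕ}

theorem CrossTimes.phase_listLinking (hP : P.IsConcatenation Ps) (hQ : Q.IsConcatenation Qs)
    (hn : P.CrossTimes Q n) : phase (listLinking P.edges Q.edges) = (-1) ^ n := by
  rw [listLinking_eq_two_mul hn.1 hP.len_pos hQ.len_pos, hn.2, phase_two_mul_natCast]

theorem CrossTimes.commute_positive (hL : Generic L) (hP : P.IsConcatenation Ps)
    (hQ : Q.IsConcatenation Qs) (hn : P.CrossTimes Q n) {S T : Operator L}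
    (hS : IsPositiveString Ps S) (hT : IsPositiveString Qs T) :
    CommuteUpTo ((-1) ^ n) S T := by
  have h := (hS.isStandard hL hP).comm hL hn.1 (hT.isStandard hL hQ)
  rwa [phase_neg, hn.phase_listLinking hP hQ, ← inv_pow, inv_neg_one] at h

/-- The product of Pauli operators along a dual path detects the crossings of the two paths. -/
theorem IsStandard.commute_dual {V : Set (Vertex L)} {es fs : List (Edge L)}
    {T : Operator L} (hT : IsStandard V es T) :
    CommuteUpTo (phase (dualExp fs (listConfig es))) (fs.map sigmaZ).prod T := by
  obtain ⟨H, -, rfl⟩ := hT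
  rw [CommuteUpTo, prod_sigmaZ, monomialOp_mul, monomialOp_mul, smul_monomialOp, add_comm 0]
  congr 1
  funext i
  rw [add_zero, dualExp_add, phase_add]
  ring

theorem CrossTimes.commute_dual (hL : Generic L) (hP : P.IsConcatenation Ps)
    (hQ : Q.IsConcatenation Qs) (hn : P.CrossTimes Q n) {T : Operator L}
    (hT : IsPositiveString Qs T) {fs : List (Edge L)} (hfs : P.IsDualPath fs) :
    CommuteUpTo ((-1) ^ n) (fs.map sigmaZ).prod T := by
  have h := (hT.isStandard hL hQ).commute_dual (fs := fs)
  rwa [hfs.dualExp_eq hL hn.1, hn.phase_listLinking hP hQ] at h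

theorem CrossTimes.commute_dual_symm (hL : Generic L) (hP : P.IsConcatenation Ps)
    (hQ : Q.IsConcatenation Qs) (hn : P.CrossTimes Q n) {S : Operator L}
    (hS : IsPositiveString Ps S) {fs : List (Edge L)} (hfs : Q.IsDualPath fs) :
    CommuteUpTo ((-1) ^ n) S (fs.map sigmaZ).prod := by
  have h := (hS.isStandard hL hP).commute_dual (fs := fs)
  rw [hfs.dualExp_eq hL ⟨hn.1.2, hn.1.1⟩, hL.listLinking_antisymm, phase_neg,
    hn.phase_listLinking hP hQ, ← inv_pow, inv_neg_one] at h
  exact h.symm (by rw [← mul_pow]; simp)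

theorem commute_dual_dual (es fs : List (Edge L)) :
    CommuteUpTo 1 (es.map sigmaZ).prod (fs.map sigmaZ).prod := by
  rw [CommuteUpTo, prod_sigmaZ, prod_sigmaZ, monomialOp_mul, monomialOp_mul, one_smul]
  congr 1
  funext i
  rw [add_zero, mul_comm]

theorem CrossTimes.commute_positive_negative (hL : Generic L) (hP : P.IsConcatenation Ps)
    (hQ : Q.IsConcatenation Qs) (hn : P.CrossTimes Q n) {S T : Operator L}
    (hS : IsPositiveString Ps S) (hT : IsNegativeString Q Qs T) : CommuteUpTo 1 S T := by
  obtain ⟨B, fs, hB, hfs, rfl⟩ := hT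
  have h := (hn.commute_positive hL hP hQ hS hB).mul_right (hn.commute_dual_symm hL hP hQ hS hfs)
  rwa [← mul_pow, neg_one_mul, neg_neg, one_pow] at h

theorem CrossTimes.commute_negative_positive (hL : Generic L) (hP : P.IsConcatenation Ps)
    (hQ : Q.IsConcatenation Qs) (hn : P.CrossTimes Q n) {S T : Operator L}
    (hS : IsNegativeString P Ps S) (hT : IsPositiveString Qs T) : CommuteUpTo 1 S T := by
  obtain ⟨A, fs, hA, hfs, rfl⟩ := hS
  have h := (hn.commute_positive hL hP hQ hA hT).mul_left (hn.commute_dual hL hP hQ hT hfs)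
  rwa [← mul_pow, neg_one_mul, neg_neg, one_pow] at h

theorem CrossTimes.commute_negative (hL : Generic L) (hP : P.IsConcatenation Ps)
    (hQ : Q.IsConcatenation Qs) (hn : P.CrossTimes Q n) {S T : Operator L}
    (hS : IsNegativeString P Ps S) (hT : IsNegativeString Q Qs T) :
    CommuteUpTo ((-1) ^ n) S T := by
  obtain ⟨A, es, hA, hes, rfl⟩ := hS
  obtain ⟨B, fs, hB, hfs, rfl⟩ := hT
  have h1 := hn.commute_positive_negative hL hP hQ hA ⟨B, fs, hB, hfs, rfl⟩
  have h2 := (hn.commute_dual hL hP hQ hB hes).mul_right (commute_dual_dual es fs)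
  have h := h1.mul_left h2
  rwa [one_mul, mul_one] at h

end Path

end DoubleSemion

open DoubleSemion in
theorem theorem2 (L : AddSubgroup (ℤ × ℤ)) [L.FiniteIndex] (hL : Nondegenerate L)
    (P Q : Path L) (Ps Qs : List (Path L)) (hP : P.IsConcatenation Ps) (hQ : Q.IsConcatenation Qs)
    (n : ℕ) (hn : P.CrossTimes Q n) :
    (∀ A B : Operator L, Path.IsPositiveString Ps A → Path.IsPositiveString Qs B →
      (Even n → A * B - B * A = 0) ∧ (Odd n → A * B + B * A = 0)) ∧
    (∀ (a b : Particle) (A B : Operator L),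
      IsStringOperator P Ps A a → IsStringOperator Q Qs B b →
      A * B = (2 * topologicalS a.index b.index) ^ n • (B * A)) := by
  have hg := hL.generic
  constructor
  · intro A B hA hB
    have h : A * B = (-1 : ℂ) ^ n • (B * A) := hn.commute_positive hg hP hQ hA hB
    constructor
    · intro he
      rw [h, he.neg_one_pow, one_smul, sub_self]
    · intro ho
      rw [h, ho.neg_one_pow]
      ext1 ψ
      funext i
      simp
  · intro a b A B hA hB
    change CommuteUpTo _ A B
    have hsq : ((-1 : ℂ) ^ n) * (-1) ^ n = 1 := by rw [← mul_pow]; simp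
    have entry : ∀ c : ℂ, (2 : ℂ) * ((1 / 2 : ℂ) * c) = c := fun c => by ring
    cases a <;> cases b <;>
      simp only [topologicalS, Particle.index, Matrix.smul_apply, smul_eq_mul, entry,
        Matrix.of_apply, Matrix.cons_val, one_pow] <;>
      simp only [IsStringOperator] at hA hB
    · subst hA; exact .one_left
    · subst hA; exact .one_left
    · subst hA; exact .one_left
    · subst hA; exact .one_left
    · subst hB; exact .one_right
    · exact hn.commute_positive hg hP hQ hA hB
    · exact hn.commute_positive_negative hg hP hQ hA hB
    · obtain ⟨B₁, B₂, h₁, h₂, rfl⟩ := hB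
      have h := (hn.commute_positive hg hP hQ hA h₁).mul_right
        (hn.commute_positive_negative hg hP hQ hA h₂)
      rwa [mul_one] at h
    · subst hB; exact .one_right
    · exact hn.commute_negative_positive hg hP hQ hA hB
    · exact hn.commute_negative hg hP hQ hA hB
    · obtain ⟨B₁, B₂, h₁, h₂, rfl⟩ := hB
      have h := (hn.commute_negative_positive hg hP hQ hA h₁).mul_right
        (hn.commute_negative hg hP hQ hA h₂)
      rwa [one_mul] at h
    · subst hB; exact .one_right
    · obtain ⟨A₁, A₂, h₁, h₂, rfl⟩ := hA
      have h := (hn.commute_positive hg hP hQ h₁ hB).mul_left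
        (hn.commute_negative_positive hg hP hQ h₂ hB)
      rwa [mul_one] at h
    · obtain ⟨A₁, A₂, h₁, h₂, rfl⟩ := hA
      have h := (hn.commute_positive_negative hg hP hQ h₁ hB).mul_left
        (hn.commute_negative hg hP hQ h₂ hB)
      rwa [one_mul] at h
    · obtain ⟨A₁, A₂, h₁, h₂, rfl⟩ := hA
      obtain ⟨B₁, B₂, k₁, k₂, rfl⟩ := hB
      have h := ((hn.commute_positive hg hP hQ h₁ k₁).mul_left
        (hn.commute_negative_positive hg hP hQ h₂ k₁)).mul_right
        ((hn.commute_positive_negative hg hP hQ h₁ k₂).mul_left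
        (hn.commute_negative hg hP hQ h₂ k₂))
      rwa [mul_one, one_mul, hsq] at h
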